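/- Let $R>0$, $\Omega^R=\mathbb R^2\times(0,R)$, $\Omega_0^R=(-\pi,\pi)^2\times(0,R)$, $\Gamma_0^h=(-\pi,\pi)^2\times\{h\}$, and let $\alpha\in\mathbb R^2$. A function on $\Omega^R$ is $\alpha$-quasi-periodic if $u(\underline x+2\pi j,x_3)=e^{-2\pi i\alpha\cdot j}u(\underline x,x_3)$ for all $j\in\mathbb Z^2$; such functions are identified with their restrictions to $\Omega_0^R$, and weak derivatives are those of the quasi-periodic function on $\Omega^R$. Let $\varepsilon_r\in L^\infty(\mathbb R^2\times(0,\infty);\mathbb C)$ be $2\pi$-periodic in $x_1$ and $x_2$ with $\operatorname{Re}\varepsilon_r\ge\varepsilon_0>0$ almost everywhere. Let $\tilde X_\alpha$ be the space of $\alpha$-quasi-periodic fields $u\in L^2(\Omega_0^R)^3$ with $\nabla\times u\in L^2(\Omega_0^R)^3$, with tangential trace $u_T=0$ on $\Gamma_0^0$ and with $u_T\in H^{1/2}_\alpha(\Gamma_0^R)^2$ on $\Gamma_0^R$, normed by $$\|u\|_{\tilde X_\alpha}^2=\|u\|_{L^2(\Omega_0^R)}^2+\|\nabla\times u\|_{L^2(\Omega_0^R)}^2+\sum_{j\in\mathbb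 Z^2}(1+|\alpha+j|^2)^{1/2}\,|\hat u_{T,j}|^2,\qquad \hat u_{T,j}=\frac1{2\pi}\int_{\Gamma_0^R}u_T\,e^{i(\alpha+j)\cdot\underline x}\,dS .$$ Let $W_0$ be the space of $\alpha$-quasi-periodic functions $w\in H^1_\alpha(\Omega_0^R)$ with $w=0$ on $\Gamma_0^0\cup\Gamma_0^R$, and put $$\tilde Y_\alpha=\{u\in\tilde X_\alpha:\operatorname{div}(\varepsilon_r u)=0 \text{ in }\Omega^R\},\qquad \tilde Y_\alpha^\perp=\{u\in\tilde X_\alpha: u=\nabla w \text{ for some } w\in W_0\},$$ where the divergence is taken in the sense of distributions. Then $\tilde Y_\alpha$ and $\tilde Y_\alpha^\perp$ are closed subspaces of $\tilde X_\alpha$, and $\tilde X_\alpha=\tilde Y_\alpha\oplus\tilde Y_\alpha^\perp$ as a direct sum. Moreover, for every $E\in\tilde X_\alpha$ there is exactly one $w\in W_0$ with $$\int_{\Omega_0^R}\varepsilon_r\nabla w\cdot\nabla\overline v\,dx=\int_{\Omega_0^R}\varepsilon_r E\cdot\nabla\overline v\,dx\qquad\text{for all } v\in W_0,$$ and $\nabla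 w\in\tilde Y_\alpha^\perp$, $E-\nabla w\in\tilde Y_\alpha$. -/

import Mathlib

open MeasureTheory Set
open scoped ContDiff ComplexConjugate ENNReal

noncomputable section

namespace QPMaxwell

/-- The vector space `ℂⁿ` with its Euclidean norm. -/
abbrev CVec (n : ℕ) := EuclideanSpace ℂ (Fin n)

/-- The upper half space `ℝ² × (0, ∞)`. -/
def halfSpace : Set (Fin 3 → ℝ) := {x | 0 < x 2}

/-- One period `(-π, π)² × (0, R)` of the layer `ℝ² × (0, R)`. -/
def cell (R : ℝ) : Set (Fin 3 → ℝ) :=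
  {x | x 0 ∈ Ioo (-Real.pi) Real.pi ∧ x 1 ∈ Ioo (-Real.pi) Real.pi ∧ x 2 ∈ Ioo 0 R}

/-- The square `(-π, π)²`. -/
def square : Set (Fin 2 → ℝ) :=
  {y | y 0 ∈ Ioo (-Real.pi) Real.pi ∧ y 1 ∈ Ioo (-Real.pi) Real.pi}

/-- The point `(y₁, y₂, h)`. -/
def atHeight (h : ℝ) (y : Fin 2 → ℝ) : Fin 3 → ℝ := ![y 0, y 1, h]

/-- Square integrable scalar functions on the cell. An `α`-quasi-periodic function on the layer is
identified with its restriction to the cell. -/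
abbrev L2Scalar (R : ℝ) := Lp ℂ 2 (volume.restrict (cell R))

/-- Square integrable vector fields on the cell. -/
abbrev L2Field (R : ℝ) := Lp (CVec 3) 2 (volume.restrict (cell R))

/-- Square integrable tangential fields `(g₁, g₂)` on a horizontal face of the cell. -/
abbrev L2Tangential := Lp (CVec 2) 2 (volume.restrict square)

/-- The horizontal period vector `(2πj₁, 2πj₂, 0)`. -/
def period (j : Fin 2 → ℤ) : Fin 3 → ℝ := ![2 * Real.pi * j 0, 2 * Real.pi * j 1, 0]

/-- `f (x + 2πj) = exp (-2πi α·j) f x` for all `j ∈ ℤ²`. -/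
def QuasiPeriodic {F : Type*} [SMul ℂ F] (α : Fin 2 → ℝ) (f : (Fin 3 → ℝ) → F) : Prop :=
  ∀ (j : Fin 2 → ℤ) (x : Fin 3 → ℝ),
    f (x + period j) =
      Complex.exp (-(2 * Real.pi * Complex.I * ((α 0 * j 0 + α 1 * j 1 : ℝ) : ℂ))) • f x

/-- Smooth `α`-quasi-periodic functions. No condition is imposed at `x₃ = 0` and `x₃ = R`. -/
structure IsSmoothQP {F : Type*} [NormedAddCommGroup F] [NormedSpace ℂ F]
    (α : Fin 2 → ℝ) (f : (Fin 3 → ℝ) → F) : Prop where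
  smooth : ContDiff ℝ ∞ f
  quasiPeriodic : QuasiPeriodic α f

/-- The partial derivative `∂f/∂xᵢ`. -/
def pderiv (i : Fin 3) (f : (Fin 3 → ℝ) → ℂ) (x : Fin 3 → ℝ) : ℂ :=
  fderiv ℝ f x (Pi.single i 1)

/-- The classical gradient. -/
def grad (f : (Fin 3 → ℝ) → ℂ) (x : Fin 3 → ℝ) : CVec 3 :=
  !₂[pderiv 0 f x, pderiv 1 f x, pderiv 2 f x]

/-- The classical divergence. -/
def div (Φ : (Fin 3 → ℝ) → CVec 3) (x : Fin 3 → ℝ) : ℂ :=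
  pderiv 0 (fun y => Φ y 0) x + pderiv 1 (fun y => Φ y 1) x + pderiv 2 (fun y => Φ y 2) x

/-- The classical curl. -/
def curl (Φ : (Fin 3 → ℝ) → CVec 3) (x : Fin 3 → ℝ) : CVec 3 :=
  !₂[pderiv 1 (fun y => Φ y 2) x - pderiv 2 (fun y => Φ y 1) x,
     pderiv 2 (fun y => Φ y 0) x - pderiv 0 (fun y => Φ y 2) x,
     pderiv 0 (fun y => Φ y 1) x - pderiv 1 (fun y => Φ y 0) x]

/-- The `α`-quasi-periodic extension of `w` to the layer has the weak gradient `G`, and `w` has the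
traces `t₀` at `x₃ = 0` and `t₁` at `x₃ = R`, expressed by Green's formula
`∫ G·Φ̄ + ∫ w div Φ̄ = ∫ t₁ Φ̄₃(·, R) - ∫ t₀ Φ̄₃(·, 0)` against smooth quasi-periodic `Φ`: the
contributions of opposite lateral faces cancel exactly for quasi-periodic `w`. Testing over the
cell with quasi-periodic functions is the same as testing the extension over the layer with
functions of bounded horizontal support (sum over the periods). Mathlib's `inner ℂ a b` is
`∑ conj (a i) * b i`. -/
def HasWeakGrad (α : Fin 2 → ℝ) (R : ℝ) (w : (Fin 3 → ℝ) → ℂ) (G : (Fin 3 → ℝ) → CVec 3)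
    (t₀ t₁ : (Fin 2 → ℝ) → ℂ) : Prop :=
  ∀ Φ : (Fin 3 → ℝ) → CVec 3, IsSmoothQP α Φ →
    (∫ x in cell R, inner ℂ (Φ x) (G x)) + (∫ x in cell R, conj (div Φ x) * w x) =
      (∫ y in square, conj (Φ (atHeight R y) 2) * t₁ y) -
        ∫ y in square, conj (Φ (atHeight 0 y) 2) * t₀ y

/-- The `α`-quasi-periodic extension of `u` to the layer has the weak curl `c`, and `u` has the
tangential traces `u_T = t₀` at `x₃ = 0` and `u_T = t₁` at `x₃ = R`, expressed by Green's formula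
`∫ c·Φ̄ - ∫ u·curl Φ̄ = ∫ e₃·(t₁ × Φ̄(·, R)) - ∫ e₃·(t₀ × Φ̄(·, 0))` against smooth
quasi-periodic `Φ`. -/
def HasWeakCurl (α : Fin 2 → ℝ) (R : ℝ) (u c : (Fin 3 → ℝ) → CVec 3)
    (t₀ t₁ : (Fin 2 → ℝ) → CVec 2) : Prop :=
  ∀ Φ : (Fin 3 → ℝ) → CVec 3, IsSmoothQP α Φ →
    (∫ x in cell R, inner ℂ (Φ x) (c x)) - (∫ x in cell R, inner ℂ (curl Φ x) (u x)) =
      (∫ y in square, (conj (Φ (atHeight R y) 1) * t₁ y 0 - conj (Φ (atHeight R y) 0) * t₁ y 1)) -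
        ∫ y in square, (conj (Φ (atHeight 0 y) 1) * t₀ y 0 - conj (Φ (atHeight 0 y) 0) * t₀ y 1)

/-- The coefficient of `g` with respect to the orthonormal system
`(2π)⁻¹ exp (-i (α + j)·y)`, `j ∈ ℤ²`. -/
def fourierCoeff (α : Fin 2 → ℝ) (g : (Fin 2 → ℝ) → CVec 2) (j : Fin 2 → ℤ) : CVec 2 :=
  ((2 * Real.pi : ℝ) : ℂ)⁻¹ • ∫ y in square,
    Complex.exp (Complex.I * (((α 0 + j 0) * y 0 + (α 1 + j 1) * y 1 : ℝ) : ℂ)) • g y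

/-- `(1 + |α + j|²)^(1/4)`. -/
def traceWeight (α : Fin 2 → ℝ) (j : Fin 2 → ℤ) : ℝ :=
  (1 + ((α 0 + j 0) ^ 2 + (α 1 + j 1) ^ 2)) ^ (1 / 4 : ℝ)

/-- The Hilbert space in which a field is recorded together with its curl and the weighted Fourier
coefficients of its upper tangential trace. -/
abbrev Ambient (R : ℝ) :=
  WithLp 2 (L2Field R × WithLp 2 (L2Field R × lp (fun _ : Fin 2 → ℤ => CVec 2) 2))

theorem measurableSet_cell (R : ℝ) : MeasurableSet (cell R) := by
  unfold cell
  simp only [mem_Ioo]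
  measurability

theorem cell_subset (R : ℝ) :
    cell R ⊆ Icc ![-Real.pi, -Real.pi, 0] ![Real.pi, Real.pi, R] := by
  rintro x ⟨h0, h1, h2⟩
  constructor <;> intro i <;> fin_cases i <;> simp
  · exact h0.1.le
  · exact h1.1.le
  · exact h2.1.le
  · exact h0.2.le
  · exact h1.2.le
  · exact h2.2.le

theorem cell_subset_halfSpace (R : ℝ) : cell R ⊆ halfSpace := fun _ hx => hx.2.2.1

instance (R : ℝ) : IsFiniteMeasure (volume.restrict (cell R)) :=
  ⟨by
    rw [Measure.restrict_apply_univ]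
    exact lt_of_le_of_lt (measure_mono (cell_subset R)) isCompact_Icc.measure_lt_top⟩

theorem square_subset : square ⊆ Icc ![-Real.pi, -Real.pi] ![Real.pi, Real.pi] := by
  rintro x ⟨h0, h1⟩
  constructor <;> intro i <;> fin_cases i <;> simp
  · exact h0.1.le
  · exact h1.1.le
  · exact h0.2.le
  · exact h1.2.le

theorem measurableSet_square : MeasurableSet square := by
  unfold square
  simp only [mem_Ioo]
  measurability

instance : IsFiniteMeasure (volume.restrict square) :=
  ⟨by
    rw [Measure.restrict_apply_univ]
    exact lt_of_le_of_lt (measure_mono square_subset) isCompact_Icc.measure_lt_top⟩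

theorem memLp_cell {F : Type*} [NormedAddCommGroup F] [SecondCountableTopology F]
    {f : (Fin 3 → ℝ) → F} (hf : Continuous f) (R : ℝ) :
    MemLp f 2 (volume.restrict (cell R)) := by
  obtain ⟨C, hC⟩ := (isCompact_Icc (a := ![-Real.pi, -Real.pi, 0])
    (b := ![Real.pi, Real.pi, R])).exists_bound_of_continuousOn hf.continuousOn
  refine MemLp.of_bound hf.aestronglyMeasurable C ?_
  filter_upwards [ae_restrict_mem (measurableSet_cell R)] with x hx
  exact hC x (cell_subset R hx)

theorem memLp_square {F : Type*} [NormedAddCommGroup F] [SecondCountableTopology F]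
    {f : (Fin 2 → ℝ) → F} (hf : Continuous f) :
    MemLp f 2 (volume.restrict square) := by
  obtain ⟨C, hC⟩ := (isCompact_Icc (a := ![-Real.pi, -Real.pi])
    (b := ![Real.pi, Real.pi])).exists_bound_of_continuousOn hf.continuousOn
  refine MemLp.of_bound hf.aestronglyMeasurable C ?_
  filter_upwards [ae_restrict_mem measurableSet_square] with x hx
  exact hC x (square_subset hx)

theorem continuous_atHeight (h : ℝ) : Continuous (atHeight h) := by
  unfold atHeight
  refine continuous_pi fun i => ?_
  fin_cases i <;> simp <;> fun_prop

theorem continuous_pderiv {f : (Fin 3 → ℝ) → ℂ} (hf : ContDiff ℝ ∞ f) (i : Fin 3) :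
    Continuous (pderiv i f) :=
  (hf.continuous_fderiv (by simp)).clm_apply continuous_const

theorem contDiff_comp {Φ : (Fin 3 → ℝ) → CVec 3} (hΦ : ContDiff ℝ ∞ Φ) (k : Fin 3) :
    ContDiff ℝ ∞ (fun y => Φ y k) :=
  ((contDiff_piLp (p := 2)).1 hΦ) k

theorem continuous_grad {f : (Fin 3 → ℝ) → ℂ} (hf : ContDiff ℝ ∞ f) : Continuous (grad f) := by
  refine (PiLp.continuous_toLp 2 _).comp (continuous_pi fun i => ?_)
  fin_cases i <;> exact continuous_pderiv hf _

theorem continuous_div {Φ : (Fin 3 → ℝ) → CVec 3} (hΦ : ContDiff ℝ ∞ Φ) : Continuous (div Φ) :=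
  ((continuous_pderiv (contDiff_comp hΦ _) _).add (continuous_pderiv (contDiff_comp hΦ _) _)).add
    (continuous_pderiv (contDiff_comp hΦ _) _)

theorem continuous_curl {Φ : (Fin 3 → ℝ) → CVec 3} (hΦ : ContDiff ℝ ∞ Φ) :
    Continuous (curl Φ) := by
  refine (PiLp.continuous_toLp 2 _).comp (continuous_pi fun i => ?_)
  fin_cases i <;>
    exact (continuous_pderiv (contDiff_comp hΦ _) _).sub (continuous_pderiv (contDiff_comp hΦ _) _)

/-! Linearity of the pairings, needed to see that the spaces below are linear subspaces. -/

theorem integrable_pair {X F : Type*} [MeasurableSpace X] {μ : Measure X} [NormedAddCommGroup F]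
    [InnerProductSpace ℂ F] {f : X → F} (hf : MemLp f 2 μ) (u : Lp F 2 μ) :
    Integrable (fun x => inner ℂ (f x) (u x)) μ := by
  refine (L2.integrable_inner (𝕜 := ℂ) (hf.toLp f) u).congr ?_
  filter_upwards [hf.coeFn_toLp] with x hx
  rw [hx]

theorem pair_add {X : Type*} [MeasurableSpace X] {μ : Measure X} {n : ℕ} {f : X → CVec n}
    (hf : MemLp f 2 μ) (u v : Lp (CVec n) 2 μ) :
    ∫ x, inner ℂ (f x) ((u + v : Lp (CVec n) 2 μ) x) ∂μ =
      (∫ x, inner ℂ (f x) (u x) ∂μ) + ∫ x, inner ℂ (f x) (v x) ∂μ := by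
  rw [← integral_add (integrable_pair hf u) (integrable_pair hf v)]
  refine integral_congr_ae ?_
  filter_upwards [Lp.coeFn_add u v] with x hx
  rw [hx, Pi.add_apply, inner_add_right]

theorem pair_smul {X : Type*} [MeasurableSpace X] {μ : Measure X} {n : ℕ} (f : X → CVec n)
    (a : ℂ) (u : Lp (CVec n) 2 μ) :
    ∫ x, inner ℂ (f x) ((a • u : Lp (CVec n) 2 μ) x) ∂μ = a * ∫ x, inner ℂ (f x) (u x) ∂μ := by
  rw [← integral_const_mul]
  refine integral_congr_ae ?_
  filter_upwards [Lp.coeFn_smul a u] with x hx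
  rw [hx, Pi.smul_apply, inner_smul_right]

theorem pair_zero {X : Type*} [MeasurableSpace X] {μ : Measure X} {n : ℕ} (f : X → CVec n) :
    ∫ x, inner ℂ (f x) ((0 : Lp (CVec n) 2 μ) x) ∂μ = 0 := by
  simpa using pair_smul (μ := μ) f 0 0

theorem spair_add {X : Type*} [MeasurableSpace X] {μ : Measure X} {f : X → ℂ}
    (hf : MemLp f 2 μ) (u v : Lp ℂ 2 μ) :
    ∫ x, conj (f x) * (u + v : Lp ℂ 2 μ) x ∂μ =
      (∫ x, conj (f x) * u x ∂μ) + ∫ x, conj (f x) * v x ∂μ := by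
  have h : ∀ w : Lp ℂ 2 μ, Integrable (fun x => conj (f x) * w x) μ := fun w => by
    refine (integrable_pair hf w).congr (.of_forall fun x => ?_)
    simp [mul_comm]
  rw [← integral_add (h u) (h v)]
  refine integral_congr_ae ?_
  filter_upwards [Lp.coeFn_add u v] with x hx
  rw [hx, Pi.add_apply, mul_add]

theorem spair_smul {X : Type*} [MeasurableSpace X] {μ : Measure X} (f : X → ℂ)
    (a : ℂ) (u : Lp ℂ 2 μ) :
    ∫ x, conj (f x) * (a • u : Lp ℂ 2 μ) x ∂μ = a * ∫ x, conj (f x) * u x ∂μ := by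
  rw [← integral_const_mul]
  refine integral_congr_ae ?_
  filter_upwards [Lp.coeFn_smul a u] with x hx
  rw [hx, Pi.smul_apply, smul_eq_mul]
  ring

theorem tangential_pair (p q : ℂ) (t : CVec 2) :
    conj p * t 0 - conj q * t 1 = inner ℂ (!₂[p, -q] : CVec 2) t := by
  simp [PiLp.inner_apply, Fin.sum_univ_two]
  ring

theorem memLp_tangential {Φ : (Fin 3 → ℝ) → CVec 3} (hΦ : ContDiff ℝ ∞ Φ) (h : ℝ) :
    MemLp (fun y => (!₂[Φ (atHeight h y) 1, -Φ (atHeight h y) 0] : CVec 2)) 2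
      (volume.restrict square) := by
  refine memLp_square ((PiLp.continuous_toLp 2 _).comp (continuous_pi fun i => ?_))
  have hc : ∀ k, Continuous fun y => Φ (atHeight h y) k := fun k =>
    (contDiff_comp hΦ k).continuous.comp (continuous_atHeight h)
  fin_cases i
  · exact hc 1
  · exact (hc 0).neg

theorem integrable_fourier (α : Fin 2 → ℝ) (g : L2Tangential) (j : Fin 2 → ℤ) :
    Integrable (fun y : Fin 2 → ℝ => Complex.exp (Complex.I *
      (((α 0 + j 0) * y 0 + (α 1 + j 1) * y 1 : ℝ) : ℂ)) • (g y : CVec 2))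
      (volume.restrict square) := by
  have hg : Integrable (fun y => (g y : CVec 2)) (volume.restrict square) :=
    (Lp.memLp g).integrable (by norm_num)
  have hc : Continuous (fun y : Fin 2 → ℝ => Complex.exp (Complex.I *
      (((α 0 + j 0) * y 0 + (α 1 + j 1) * y 1 : ℝ) : ℂ))) := by fun_prop
  refine hg.bdd_smul 1 hc.aestronglyMeasurable (.of_forall fun y => ?_)
  rw [mul_comm, Complex.norm_exp_ofReal_mul_I]

theorem fourierCoeff_add (α : Fin 2 → ℝ) (g h : L2Tangential) (j : Fin 2 → ℤ) :
    fourierCoeff α (g + h : L2Tangential) j = fourierCoeff α g j + fourierCoeff α h j := by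
  unfold fourierCoeff
  rw [← smul_add, ← integral_add (integrable_fourier α g j) (integrable_fourier α h j)]
  congr 1
  refine integral_congr_ae ?_
  filter_upwards [Lp.coeFn_add g h] with x hx
  rw [hx, Pi.add_apply, smul_add]

theorem fourierCoeff_smul (α : Fin 2 → ℝ) (a : ℂ) (g : L2Tangential) (j : Fin 2 → ℤ) :
    fourierCoeff α (a • g : L2Tangential) j = a • fourierCoeff α g j := by
  unfold fourierCoeff
  rw [smul_comm a, ← integral_smul a]
  congr 1
  refine integral_congr_ae ?_
  filter_upwards [Lp.coeFn_smul a g] with x hx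
  rw [hx, Pi.smul_apply, smul_comm]

/-- The quasi-periodic solution space: fields `u ∈ H_α(curl)` on the cell with `u_T = 0` at
`x₃ = 0` and `u_T ∈ TH_α^{1/2}` at `x₃ = R`. An element is the triple of `u`, of `curl u` and of
the weighted Fourier coefficients of `u_T` at `x₃ = R` (the last two are determined by `u`), so
that the norm inherited from the ambient space is given by
`‖u‖² + ‖curl u‖² + ∑ⱼ (1 + |α + j|²)^{1/2} |û_{T,j}|²`. -/
def X (α : Fin 2 → ℝ) (R : ℝ) : Submodule ℂ (Ambient R) where
  carrier := {p | ∃ g : L2Tangential,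
    HasWeakCurl α R p.fst p.snd.fst 0 g ∧
      ∀ j, p.snd.snd j = traceWeight α j • fourierCoeff α g j}
  add_mem' := by
    rintro p q ⟨g, hg, hgj⟩ ⟨h, hh, hhj⟩
    refine ⟨g + h, fun Φ hΦ => ?_, fun j => ?_⟩
    · have h1 := hg Φ hΦ
      have h2 := hh Φ hΦ
      simp only [tangential_pair] at h1 h2 ⊢
      rw [WithLp.add_fst, WithLp.add_snd, WithLp.add_fst,
        pair_add (memLp_cell hΦ.smooth.continuous R),
        pair_add (memLp_cell (continuous_curl hΦ.smooth) R),
        pair_add (memLp_tangential hΦ.smooth R)]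
      simp only [Pi.zero_apply, inner_zero_right, integral_zero] at h1 h2 ⊢
      linear_combination h1 + h2
    · rw [fourierCoeff_add, smul_add, ← hgj, ← hhj]
      rfl
  zero_mem' := by
    refine ⟨0, fun Φ hΦ => ?_, fun j => ?_⟩
    · simp only [tangential_pair]
      rw [WithLp.zero_fst, WithLp.zero_snd, WithLp.zero_fst, pair_zero, pair_zero, pair_zero]
      simp
    · have : fourierCoeff α (0 : L2Tangential) j = 0 := by
        simpa using fourierCoeff_smul α 0 0 j
      rw [this, smul_zero]
      rfl
  smul_mem' := by
    rintro a p ⟨g, hg, hgj⟩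
    refine ⟨a • g, fun Φ hΦ => ?_, fun j => ?_⟩
    · have h1 := hg Φ hΦ
      simp only [tangential_pair] at h1 ⊢
      rw [WithLp.smul_fst, WithLp.smul_snd, WithLp.smul_fst, pair_smul, pair_smul, pair_smul]
      simp only [Pi.zero_apply, inner_zero_right, integral_zero] at h1 ⊢
      linear_combination a * h1
    · rw [fourierCoeff_smul, smul_comm, ← hgj]
      rfl

/-- The functions `w ∈ H¹_α` on the cell with `w = 0` at `x₃ = 0` and at `x₃ = R`, recorded as
pairs of `w` and `∇w` (which is determined by `w`). -/
def W₀ (α : Fin 2 → ℝ) (R : ℝ) : Submodule ℂ (WithLp 2 (L2Scalar R × L2Field R)) where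
  carrier := {p | HasWeakGrad α R p.fst p.snd 0 0}
  add_mem' := by
    intro p q hp hq Φ hΦ
    have h1 := hp Φ hΦ
    have h2 := hq Φ hΦ
    rw [WithLp.add_fst, WithLp.add_snd, pair_add (memLp_cell hΦ.smooth.continuous R),
      spair_add (memLp_cell (continuous_div hΦ.smooth) R)]
    simp only [Pi.zero_apply, mul_zero, integral_zero] at h1 h2 ⊢
    linear_combination h1 + h2
  zero_mem' := by
    intro Φ hΦ
    have : ∫ x in cell R, conj (div Φ x) * (0 : L2Scalar R) x = 0 := by
      simpa using spair_smul (div Φ) 0 (0 : L2Scalar R)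
    rw [WithLp.zero_fst, WithLp.zero_snd, pair_zero, this]
    simp
  smul_mem' := by
    intro a p hp Φ hΦ
    have h1 := hp Φ hΦ
    rw [WithLp.smul_fst, WithLp.smul_snd, pair_smul, spair_smul]
    simp only [Pi.zero_apply, mul_zero, integral_zero] at h1 ⊢
    linear_combination a * h1

/-- `div (ε u) = 0` in the sense of distributions, for the quasi-periodic extension of `u` and the
periodic function `ε`: `∫ ε u·∇φ̄ = 0` for all smooth `α`-quasi-periodic `φ` that vanish near
`x₃ = 0` and near `x₃ = R`. -/
def DivZero (α : Fin 2 → ℝ) (R : ℝ) (ε : (Fin 3 → ℝ) → ℂ) (u : (Fin 3 → ℝ) → CVec 3) : Prop :=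
  ∀ φ : (Fin 3 → ℝ) → ℂ, IsSmoothQP α φ →
    (∃ a b : ℝ, 0 < a ∧ b < R ∧ ∀ x, φ x ≠ 0 → x 2 ∈ Icc a b) →
      ∫ x in cell R, inner ℂ (grad φ x) (ε x • u x) = 0

theorem memLp_coeff {ε : (Fin 3 → ℝ) → ℂ} (hε : MemLp ε ∞ (volume.restrict halfSpace)) {R : ℝ}
    {f : (Fin 3 → ℝ) → CVec 3} (hf : MemLp f 2 (volume.restrict (cell R))) :
    MemLp (fun x => conj (ε x) • f x) 2 (volume.restrict (cell R)) := by
  have h : MemLp (fun x => conj (ε x)) ∞ (volume.restrict (cell R)) :=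
    (hε.mono_measure (Measure.restrict_mono (cell_subset_halfSpace R) le_rfl)).star
  exact hf.smul h

theorem inner_coeff (e : ℂ) (a b : CVec 3) : inner ℂ a (e • b) = inner ℂ (conj e • a) b := by
  rw [inner_smul_left, inner_smul_right, Complex.conj_conj]

/-- The fields `u` of the solution space with `div (ε u) = 0`. -/
def Y (α : Fin 2 → ℝ) (R : ℝ) (ε : (Fin 3 → ℝ) → ℂ)
    (hε : MemLp ε ∞ (volume.restrict halfSpace)) : Submodule ℂ (X α R) where
  carrier := {p | DivZero α R ε p.1.fst}
  add_mem' := by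
    intro p q hp hq φ hφ hs
    have h1 := hp φ hφ hs
    have h2 := hq φ hφ hs
    simp only [inner_coeff] at h1 h2 ⊢
    rw [Submodule.coe_add, WithLp.add_fst,
      pair_add (memLp_coeff hε (memLp_cell (continuous_grad hφ.smooth) R)), h1, h2, add_zero]
  zero_mem' := by
    intro φ hφ hs
    simp only [inner_coeff]
    rw [Submodule.coe_zero, WithLp.zero_fst, pair_zero]
  smul_mem' := by
    intro a p hp φ hφ hs
    have h1 := hp φ hφ hs
    simp only [inner_coeff] at h1 ⊢
    rw [Submodule.coe_smul, WithLp.smul_fst, pair_smul, h1, mul_zero]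

/-- The fields of the solution space that are gradients `∇w` of functions `w ∈ W₀`. -/
def Yperp (α : Fin 2 → ℝ) (R : ℝ) : Submodule ℂ (X α R) where
  carrier := {p | ∃ w ∈ W₀ α R, p.1.fst = w.snd}
  add_mem' := by
    rintro p q ⟨v, hv, hpv⟩ ⟨w, hw, hqw⟩
    exact ⟨v + w, add_mem hv hw, by
      rw [Submodule.coe_add, WithLp.add_fst, WithLp.add_snd, hpv, hqw]⟩
  zero_mem' := ⟨0, zero_mem _, rfl⟩
  smul_mem' := by
    rintro a p ⟨w, hw, hpw⟩
    exact ⟨a • w, Submodule.smul_mem _ a hw, by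
      rw [Submodule.coe_smul, WithLp.smul_fst, WithLp.smul_snd, hpw]⟩

/-- `w ∈ W₀` is the weak solution of `div (ε ∇w) = div (ε E)`:
`∫ ε ∇w·∇v̄ = ∫ ε E·∇v̄` for all `v ∈ W₀`. -/
def SolvesWeighted (α : Fin 2 → ℝ) (R : ℝ) (ε : (Fin 3 → ℝ) → ℂ) (E : (Fin 3 → ℝ) → CVec 3)
    (w : W₀ α R) : Prop :=
  ∀ v : W₀ α R, ∫ x in cell R, inner ℂ (v.1.snd x) (ε x • w.1.snd x) =
    ∫ x in cell R, inner ℂ (v.1.snd x) (ε x • E x)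

end QPMaxwell

end

noncomputable section

namespace QPMaxwell

/-! Let `G : W₀ → L²` be the gradient and `D = G* ∘ ε`, so that `⟨v, D u⟩ = ∫ ε u·∇v̄` for `v ∈ W₀`.
By Poincaré's inequality and `Re ε ≥ ε₀`, the operator `D G` is coercive on `W₀`, hence bijective by
Lax–Milgram. The weighted equation for `w` reads `D G w = D E`, so it has exactly one solution, and
`E - ∇w` lies in the kernel of `D`.

The rest follows from describing both subspaces through the field `u` alone: `Y` is the kernel of `u
↦ D u`, and `Yperp` is the preimage of the range of `G`. The first is closed because `D` is
continuous, the second because `G` is bounded below. If `u = G w` and `D u = 0`, then `w = 0` and `u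
= 0`.

Three facts make this work for spaces defined by Green's formulas. (1) The distributional equation
`div (ε u) = 0` tests only functions vanishing near the faces, so density of these in `W₀` is needed
(`W₀.eq_zero_of_inner_smoothPair`, used in `divZero_iff`). (2) Gradients of `W₀` lie in `X` with
zero curl and zero trace, because `div curl = 0` (`W₀.gradient_mem_X`). (3) The curl and the trace
coefficients are determined by the field (`X.eq_zero_of_fst`).

Poincaré's inequality, (1) and (3) are all read off from coefficients against the exponentials
`mode`, using Parseval's identity on the cell. The exponentials need not vanish on the faces; the
traces built into the definitions account for the boundary terms. -/

/-- The smooth quasi-periodic exponential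
`exp (i ((n₀ - α₀) x₀ + (n₁ - α₁) x₁ + 2π n₂ x₂ / R))`. -/
def mode (α : Fin 2 → ℝ) (R : ℝ) (n : Fin 3 → ℤ) (x : Fin 3 → ℝ) : ℂ :=
  Complex.exp (Complex.I *
    (((n 0 - α 0) * x 0 + (n 1 - α 1) * x 1 + 2 * Real.pi * n 2 / R * x 2 : ℝ) : ℂ))

/-! ### Parseval's identity on the cell, transported from the unit torus. -/

/-- The side lengths of the cell. -/
def sides (R : ℝ) : Fin 3 → ℝ := ![2 * Real.pi, 2 * Real.pi, R]

theorem sides_pos {R : ℝ} (hR : 0 < R) (i : Fin 3) : 0 < sides R i := by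
  have := Real.pi_pos
  fin_cases i <;> simp [sides] <;> positivity

/-- The lower corner of the unit box that is rescaled to the cell. -/
def corner : Fin 3 → ℝ := ![-(1 / 2), -(1 / 2), 0]

/-- The linear map that rescales the unit box to the cell. -/
def rescale (R : ℝ) : (Fin 3 → ℝ) →ₗ[ℝ] (Fin 3 → ℝ) := Matrix.toLin' (Matrix.diagonal (sides R))

theorem rescale_apply (R : ℝ) (x : Fin 3 → ℝ) (i : Fin 3) : rescale R x i = sides R i * x i := by
  simp [rescale, Matrix.mulVec_diagonal]

theorem measurable_rescale (R : ℝ) : Measurable (rescale R) :=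
  (LinearMap.continuous_of_finiteDimensional _).measurable

theorem cell_eq_pi (R : ℝ) :
    cell R = pi univ fun i => Ioo (![-Real.pi, -Real.pi, 0] i) (![Real.pi, Real.pi, R] i) := by
  ext x
  simp [cell, Fin.forall_fin_succ, mem_pi]

theorem rescale_preimage_cell {R : ℝ} (hR : 0 < R) :
    rescale R ⁻¹' cell R = pi univ fun i => Ioo (corner i) (corner i + 1) := by
  have hpi := Real.pi_pos
  ext x
  simp only [mem_preimage, cell, mem_ofPred_eq, rescale_apply, sides, mem_Ioo, mem_pi, mem_univ,
    forall_const, Fin.forall_fin_succ, corner, IsEmpty.forall_iff, and_true, Fin.isValue]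
  simp only [Matrix.cons_val_zero, Matrix.cons_val_one, Matrix.cons_val, Fin.succ_zero_eq_one,
    Fin.succ_one_eq_two]
  refine and_congr ⟨?_, ?_⟩ (and_congr ⟨?_, ?_⟩ ⟨?_, ?_⟩) <;> rintro ⟨h1, h2⟩ <;> constructor <;>
    nlinarith

/-- Torus representatives live in a half-open box while the cell is open; the difference is part of
the boundary, a null set. -/
theorem unitBox_ae_eq {R : ℝ} (hR : 0 < R) :
    ({x : Fin 3 → ℝ | ∀ i, x i ∈ Ioc (corner i) (corner i + 1)} : Set (Fin 3 → ℝ)) =ᵐ[volume]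
      rescale R ⁻¹' cell R := by
  rw [rescale_preimage_cell hR]
  have h1 : (pi univ fun i => Ioc (corner i) (corner i + 1)) =ᵐ[volume] _ :=
    Measure.univ_pi_Ioc_ae_eq_Icc (μ := fun _ : Fin 3 => (volume : Measure ℝ)) (f := corner)
      (g := fun i => corner i + 1)
  have h2 := Measure.univ_pi_Ioo_ae_eq_Icc (μ := fun _ : Fin 3 => (volume : Measure ℝ)) (f := corner)
      (g := fun i => corner i + 1)
  have h0 : {x : Fin 3 → ℝ | ∀ i, x i ∈ Ioc (corner i) (corner i + 1)} =
      pi univ fun i => Ioc (corner i) (corner i + 1) := by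
    ext x
    simp [mem_pi]
  rw [h0]
  exact h1.trans h2.symm

/-- The volume of the cell. -/
def cellVol (R : ℝ) : ℝ := |(Matrix.diagonal (sides R)).det|

theorem cellVol_pos {R : ℝ} (hR : 0 < R) : 0 < cellVol R := by
  unfold cellVol
  rw [Matrix.det_diagonal]
  exact abs_pos.2 (Finset.prod_ne_zero_iff.2 fun i _ => (sides_pos hR i).ne')

section Torus

local instance : MeasureSpace UnitAddCircle := ⟨AddCircle.haarAddCircle⟩

local instance : Measure.IsAddHaarMeasure (volume : Measure UnitAddCircle) :=
  inferInstanceAs (Measure.IsAddHaarMeasure AddCircle.haarAddCircle)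

local instance : IsProbabilityMeasure (volume : Measure UnitAddCircle) :=
  inferInstanceAs (IsProbabilityMeasure AddCircle.haarAddCircle)

/-- The representative in the cell of a point of the torus. -/
def cellRep (R : ℝ) (t : UnitAddTorus (Fin 3)) : Fin 3 → ℝ :=
  rescale R (UnitAddTorus.measurableEquivPiIoc corner t : Fin 3 → ℝ)

/-- The torus carries a probability measure, which is why the volume of the cell is divided out. -/
theorem measurePreserving_cellRep {R : ℝ} (hR : 0 < R) :
    MeasurePreserving (cellRep R) volume
      ((ENNReal.ofReal (cellVol R))⁻¹ • volume.restrict (cell R)) := by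
  have h1 := UnitAddTorus.measurePreserving_equivPiIoc corner
  have hbox : MeasurableSet {x : Fin 3 → ℝ | ∀ i, x i ∈ Ioc (corner i) (corner i + 1)} :=
    MeasurableSet.univ_pi' fun i => measurableSet_Ioc
  have h2 : MeasurePreserving
      (Subtype.val : {x : Fin 3 → ℝ // ∀ i, x i ∈ Ioc (corner i) (corner i + 1)} → Fin 3 → ℝ)
      (Measure.comap Subtype.val volume)
      (volume.restrict {x : Fin 3 → ℝ | ∀ i, x i ∈ Ioc (corner i) (corner i + 1)}) :=
    ⟨measurable_subtype_coe, map_comap_subtype_coe hbox _⟩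
  have h3 : MeasurePreserving (rescale R)
      (volume.restrict {x : Fin 3 → ℝ | ∀ i, x i ∈ Ioc (corner i) (corner i + 1)})
      ((ENNReal.ofReal (cellVol R))⁻¹ • volume.restrict (cell R)) := by
    refine ⟨measurable_rescale R, ?_⟩
    have hc : ENNReal.ofReal (cellVol R) ≠ 0 := by simpa using cellVol_pos hR
    have hdet : (Matrix.diagonal (sides R)).det ≠ 0 := abs_pos.1 (cellVol_pos hR)
    have hmap : ENNReal.ofReal (cellVol R) • Measure.map (rescale R) volume = volume :=
      Real.smul_map_diagonal_volume_pi hdet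
    rw [Measure.restrict_congr_set (unitBox_ae_eq hR),
      ← Measure.restrict_map (measurable_rescale R) (measurableSet_cell R)]
    conv_rhs => rw [← hmap]
    rw [Measure.restrict_smul, smul_smul, ENNReal.inv_mul_cancel hc ENNReal.ofReal_ne_top, one_smul]
  exact h3.comp (h2.comp h1)

/-- A character of the torus may be evaluated at any representative; rescaling by the side lengths
then turns its frequencies into those of `mode 0 R n`. -/
theorem mFourier_neg_eq_mode {R : ℝ} (hR : 0 < R) (n : Fin 3 → ℤ) (t : UnitAddTorus (Fin 3)) :
    UnitAddTorus.mFourier (-n) t = conj (mode 0 R n (cellRep R t)) := by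
  rw [UnitAddTorus.mFourier_neg]
  congr 1
  have ht : t = fun i => (((UnitAddTorus.measurableEquivPiIoc corner t : Fin 3 → ℝ) i : ℝ) :
      UnitAddCircle) := by
    conv_lhs => rw [← (UnitAddTorus.measurableEquivPiIoc corner).symm_apply_apply t]
    rfl
  unfold mode cellRep
  generalize (UnitAddTorus.measurableEquivPiIoc corner t : Fin 3 → ℝ) = y at ht ⊢
  subst ht
  simp only [UnitAddTorus.mFourier, ContinuousMap.coe_mk, fourier_coe_apply, Fin.prod_univ_three,
    ← Complex.exp_add, rescale_apply, sides]
  congr 1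
  have : (R : ℂ) ≠ 0 := by exact_mod_cast hR.ne'
  simp
  field_simp

theorem mode_eq_mul (α : Fin 2 → ℝ) (R : ℝ) (n : Fin 3 → ℤ) (x : Fin 3 → ℝ) :
    mode α R n x = mode α R 0 x * mode 0 R n x := by
  unfold mode
  rw [← Complex.exp_add]
  congr 1
  simp
  ring

theorem norm_mode (α : Fin 2 → ℝ) (R : ℝ) (n : Fin 3 → ℤ) (x : Fin 3 → ℝ) :
    ‖mode α R n x‖ = 1 := by
  rw [mode, mul_comm, Complex.norm_exp_ofReal_mul_I]

theorem continuous_mode (α : Fin 2 → ℝ) (R : ℝ) (n : Fin 3 → ℤ) : Continuous (mode α R n) := by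
  unfold mode
  fun_prop

/-- **Parseval's identity** for the quasi-periodic exponentials on the cell. -/
theorem hasSum_sq_mode (α : Fin 2 → ℝ) {R : ℝ} (hR : 0 < R) {v : (Fin 3 → ℝ) → ℂ}
    (hv : MemLp v 2 (volume.restrict (cell R))) :
    HasSum (fun n : Fin 3 → ℤ => ‖∫ x in cell R, conj (mode α R n x) * v x‖ ^ 2)
      (cellVol R * ∫ x in cell R, ‖v x‖ ^ 2) := by
  have hmp := measurePreserving_cellRep hR
  set c := (ENNReal.ofReal (cellVol R))⁻¹ with hc
  have hcr : c.toReal = (cellVol R)⁻¹ := by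
    rw [hc, ENNReal.toReal_inv, ENNReal.toReal_ofReal (cellVol_pos hR).le]
  have hcpos := cellVol_pos hR
  have hctop : c ≠ ⊤ := by simpa [hc] using hcpos
  -- The unimodular factor `mode α R 0` carries the whole dependence on `α`. Moving it onto `v`
  -- leaves `‖v x‖` unchanged and reduces the claim to ordinary Fourier coefficients.
  have hv' : MemLp (fun x => conj (mode α R 0 x) * v x) 2 (volume.restrict (cell R)) := by
    refine hv.of_le (((Complex.continuous_conj.comp
      (continuous_mode α R 0)).aestronglyMeasurable).mul hv.1) (.of_forall fun x => ?_)
    rw [norm_mul, RCLike.norm_conj, norm_mode, one_mul]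
  have hV := (hv'.smul_measure hctop).comp_measurePreserving hmp
  have key := UnitAddTorus.hasSum_sq_mFourierCoeff hV.toLp
  have h1 : ∀ n, UnitAddTorus.mFourierCoeff hV.toLp n =
      ((cellVol R)⁻¹ : ℝ) • ∫ x in cell R, conj (mode α R n x) * v x := by
    intro n
    have e1 : UnitAddTorus.mFourierCoeff hV.toLp n =
        ∫ t, (fun x => conj (mode α R n x) * v x) (cellRep R t) := by
      refine integral_congr_ae ?_
      filter_upwards [hV.coeFn_toLp] with t ht
      rw [ht, mFourier_neg_eq_mode hR, mode_eq_mul α R n]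
      simp
      ring
    rw [e1, ← hcr, ← integral_smul_measure, ← hmp.map_eq, integral_map hmp.aemeasurable]
    rw [hmp.map_eq]
    exact ((Complex.continuous_conj.comp
      (continuous_mode α R n)).aestronglyMeasurable).mul (hv.1.smul_measure _)
  have h2 : ∫ t, ‖hV.toLp _ t‖ ^ 2 = (cellVol R)⁻¹ * ∫ x in cell R, ‖v x‖ ^ 2 := by
    have e1 : ∫ t, ‖hV.toLp _ t‖ ^ 2 = ∫ t, (fun x => ‖v x‖ ^ 2) (cellRep R t) := by
      refine integral_congr_ae ?_
      filter_upwards [hV.coeFn_toLp] with t ht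
      rw [ht]
      simp [norm_mode]
    rw [e1, ← hcr, ← smul_eq_mul, ← integral_smul_measure, ← hmp.map_eq,
      integral_map hmp.aemeasurable]
    rw [hmp.map_eq]
    exact (hv.1.smul_measure _).norm.pow 2
  rw [h2] at key
  -- Each torus coefficient carries a factor `(cellVol R)⁻¹`, which enters squared.
  have h3 := key.mul_left (cellVol R ^ 2)
  have ha : (fun n => cellVol R ^ 2 * ‖UnitAddTorus.mFourierCoeff (hV.toLp _) n‖ ^ 2) =
      fun n : Fin 3 → ℤ => ‖∫ x in cell R, conj (mode α R n x) * v x‖ ^ 2 := by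
    funext n
    rw [h1, norm_smul, mul_pow, Real.norm_eq_abs, sq_abs]
    field_simp
  have hb : cellVol R ^ 2 * ((cellVol R)⁻¹ * ∫ x in cell R, ‖v x‖ ^ 2) =
      cellVol R * ∫ x in cell R, ‖v x‖ ^ 2 := by
    field_simp
  rw [← ha, ← hb]
  exact h3

end Torus

/-! ### Calculus of smooth quasi-periodic functions. -/

theorem contDiff_pderiv {f : (Fin 3 → ℝ) → ℂ} (hf : ContDiff ℝ ∞ f) (i : Fin 3) :
    ContDiff ℝ ∞ (pderiv i f) :=
  (hf.fderiv_right (m := ∞) (by simp)).clm_apply contDiff_const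

theorem IsSmoothQP.pderiv {α : Fin 2 → ℝ} {f : (Fin 3 → ℝ) → ℂ} (hf : IsSmoothQP α f)
    (i : Fin 3) : IsSmoothQP α (pderiv i f) := by
  refine ⟨contDiff_pderiv hf.smooth i, fun j x => ?_⟩
  unfold QPMaxwell.pderiv
  have h : (fun y => f (y + period j)) = fun y =>
      Complex.exp (-(2 * Real.pi * Complex.I * ((α 0 * j 0 + α 1 * j 1 : ℝ) : ℂ))) • f y :=
    funext (hf.quasiPeriodic j)
  rw [← fderiv_comp_add_right, h,
    fderiv_fun_const_smul (hf.smooth.differentiable (by simp)).differentiableAt]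
  simp

theorem pderiv_comm {f : (Fin 3 → ℝ) → ℂ} (hf : ContDiff ℝ ∞ f) (i j : Fin 3)
    (x : Fin 3 → ℝ) : pderiv i (pderiv j f) x = pderiv j (pderiv i f) x := by
  have hs : IsSymmSndFDerivAt ℝ f x :=
    hf.contDiffAt.isSymmSndFDerivAt (by
      rw [minSmoothness_of_isRCLikeNormedField]
      exact ENat.LEInfty.out)
  have hd : DifferentiableAt ℝ (fderiv ℝ f) x :=
    ((hf.fderiv_right (m := ∞) (by simp)).differentiable (by simp)).differentiableAt
  have h : ∀ a b : Fin 3, pderiv a (pderiv b f) x =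
      fderiv ℝ (fderiv ℝ f) x (Pi.single a 1) (Pi.single b 1) := by
    intro a b
    unfold pderiv
    rw [fderiv_clm_apply hd (differentiableAt_const _)]
    simp
  rw [h, h]
  exact hs _ _

theorem IsSmoothQP.comp {α : Fin 2 → ℝ} {Φ : (Fin 3 → ℝ) → CVec 3} (hΦ : IsSmoothQP α Φ)
    (k : Fin 3) : IsSmoothQP α fun x => Φ x k :=
  ⟨contDiff_comp hΦ.smooth k, fun j x => by
    rw [hΦ.quasiPeriodic j x]
    rfl⟩

theorem IsSmoothQP.sub {α : Fin 2 → ℝ} {f g : (Fin 3 → ℝ) → ℂ} (hf : IsSmoothQP α f)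
    (hg : IsSmoothQP α g) : IsSmoothQP α fun x => f x - g x :=
  ⟨hf.smooth.sub hg.smooth, fun j x => by
    rw [hf.quasiPeriodic j x, hg.quasiPeriodic j x, smul_sub]⟩

theorem isSmoothQP_vec {α : Fin 2 → ℝ} {Φ : (Fin 3 → ℝ) → CVec 3}
    (h : ∀ k, IsSmoothQP α fun x => Φ x k) : IsSmoothQP α Φ :=
  ⟨(contDiff_piLp (p := 2)).2 fun k => (h k).smooth, fun j x => by
    ext k
    exact (h k).quasiPeriodic j x⟩

theorem IsSmoothQP.grad {α : Fin 2 → ℝ} {f : (Fin 3 → ℝ) → ℂ} (hf : IsSmoothQP α f) :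
    IsSmoothQP α (grad f) :=
  isSmoothQP_vec fun k => by fin_cases k <;> exact hf.pderiv _

theorem IsSmoothQP.curl {α : Fin 2 → ℝ} {Φ : (Fin 3 → ℝ) → CVec 3} (hΦ : IsSmoothQP α Φ) :
    IsSmoothQP α (curl Φ) :=
  isSmoothQP_vec fun k => by
    fin_cases k <;> exact ((hΦ.comp _).pderiv _).sub ((hΦ.comp _).pderiv _)

/-- Allows the vectorial Green formulas to be tested one component at a time. -/
theorem isSmoothQP_single {α : Fin 2 → ℝ} {f : (Fin 3 → ℝ) → ℂ} (hf : IsSmoothQP α f)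
    (k : Fin 3) : IsSmoothQP α fun x => (EuclideanSpace.single k (f x) : CVec 3) :=
  isSmoothQP_vec fun i => by
    by_cases h : i = k
    · subst h
      simpa using hf
    · simp only [PiLp.single_apply, h, if_false]
      exact ⟨contDiff_const, fun j x => by simp⟩

theorem pderiv_sub {f g : (Fin 3 → ℝ) → ℂ} (hf : ContDiff ℝ ∞ f) (hg : ContDiff ℝ ∞ g)
    (i : Fin 3) (x : Fin 3 → ℝ) :
    pderiv i (fun y => f y - g y) x = pderiv i f x - pderiv i g x := by
  unfold pderiv
  rw [fderiv_fun_sub (hf.differentiable (by simp)).differentiableAt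
    (hg.differentiable (by simp)).differentiableAt]
  rfl

/-- Mixed partial derivatives commute. Its use is that testing `w ∈ W₀` with a curl leaves only the
term with `∇w`. -/
theorem div_curl {Φ : (Fin 3 → ℝ) → CVec 3} (hΦ : ContDiff ℝ ∞ Φ) (x : Fin 3 → ℝ) :
    div (curl Φ) x = 0 := by
  have hd : ∀ i k, ContDiff ℝ ∞ (pderiv i fun y => Φ y k) := fun i k =>
    contDiff_pderiv (contDiff_comp hΦ k) i
  simp only [div, curl, PiLp.toLp_apply, Matrix.cons_val_zero, Matrix.cons_val_one,
    Matrix.cons_val]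
  rw [pderiv_sub (hd _ _) (hd _ _), pderiv_sub (hd _ _) (hd _ _), pderiv_sub (hd _ _) (hd _ _),
    pderiv_comm (contDiff_comp hΦ 2) 0 1, pderiv_comm (contDiff_comp hΦ 1) 0 2,
    pderiv_comm (contDiff_comp hΦ 0) 1 2]
  ring

theorem pderiv_zero (i : Fin 3) (x : Fin 3 → ℝ) : pderiv i (fun _ => 0) x = 0 := by
  simp [pderiv]

theorem div_single (f : (Fin 3 → ℝ) → ℂ) (k : Fin 3) (x : Fin 3 → ℝ) :
    div (fun y => (EuclideanSpace.single k (f y) : CVec 3)) x = pderiv k f x := by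
  fin_cases k <;> simp [div, pderiv_zero]

/-! ### Horizontal plane waves with a vertical profile. -/

/-- The product of a horizontal plane wave with a function of the height. -/
def wave (α : Fin 2 → ℝ) (j : Fin 2 → ℤ) (f : ℝ → ℂ) (x : Fin 3 → ℝ) : ℂ :=
  Complex.exp (Complex.I * (((j 0 - α 0) * x 0 + (j 1 - α 1) * x 1 : ℝ) : ℂ)) * f (x 2)

theorem isSmoothQP_wave (α : Fin 2 → ℝ) (j : Fin 2 → ℤ) {f : ℝ → ℂ} (hf : ContDiff ℝ ∞ f) :
    IsSmoothQP α (wave α j f) := by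
  refine ⟨?_, fun k x => ?_⟩
  · unfold wave
    have h0 : ContDiff ℝ ∞ fun x : Fin 3 → ℝ => (j 0 - α 0) * x 0 + (j 1 - α 1) * x 1 := by
      fun_prop
    have h1 : ContDiff ℝ ∞ fun x : Fin 3 → ℝ =>
        (((j 0 - α 0) * x 0 + (j 1 - α 1) * x 1 : ℝ) : ℂ) :=
      Complex.ofRealCLM.contDiff.comp h0
    have h2 : ContDiff ℝ ∞ fun x : Fin 3 → ℝ => f (x 2) := hf.comp (by fun_prop)
    exact (contDiff_const.mul h1).cexp.mul h2
  · have h2 : (x + period k) 2 = x 2 := by simp [period]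
    unfold wave
    rw [h2, smul_eq_mul, ← mul_assoc, ← Complex.exp_add]
    congr 1
    rw [Complex.exp_eq_exp_iff_exists_int]
    -- The shift adds `2πi (j - α)·k` to the exponent; the part `2πi j·k` is invisible and the rest
    -- is the required phase.
    refine ⟨j 0 * k 0 + j 1 * k 1, ?_⟩
    simp [period]
    ring

/-- Restriction to the line `x + t • v` reduces this to the product rule in one variable. -/
theorem fderiv_wave (α : Fin 2 → ℝ) (j : Fin 2 → ℤ) {f : ℝ → ℂ} (hf : ContDiff ℝ ∞ f)
    (x v : Fin 3 → ℝ) : fderiv ℝ (wave α j f) x v =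
      Complex.I * (((j 0 - α 0) * v 0 + (j 1 - α 1) * v 1 : ℝ) : ℂ) * wave α j f x +
        v 2 * wave α j (deriv f) x := by
  have hw : DifferentiableAt ℝ (wave α j f) x :=
    ((isSmoothQP_wave α j hf).smooth.differentiable (by simp)).differentiableAt
  rw [← hw.lineDeriv_eq_fderiv, lineDeriv]
  have hlin : HasDerivAt (fun t : ℝ => (((j 0 - α 0) * (x + t • v) 0 +
      (j 1 - α 1) * (x + t • v) 1 : ℝ) : ℂ))
      (((j 0 - α 0) * v 0 + (j 1 - α 1) * v 1 : ℝ) : ℂ) 0 := by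
    refine HasDerivAt.ofReal_comp ?_
    have h : ∀ i, HasDerivAt (fun t : ℝ => (x + t • v) i) (v i) 0 := fun i => by
      simpa using ((hasDerivAt_id (0 : ℝ)).mul_const (v i)).const_add (x i)
    exact ((h 0).const_mul _).add ((h 1).const_mul _)
  have hf' : HasDerivAt (fun t : ℝ => f ((x + t • v) 2)) (v 2 • deriv f (x 2)) 0 := by
    have h : HasDerivAt (fun t : ℝ => (x + t • v) 2) (v 2) 0 := by
      simpa using ((hasDerivAt_id (0 : ℝ)).mul_const (v 2)).const_add (x 2)
    have h2 : HasDerivAt f (deriv f (x 2)) ((x + (0 : ℝ) • v) 2) := by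
      simpa using (hf.differentiable (by simp)).differentiableAt.hasDerivAt (x := x 2)
    exact h2.scomp 0 h
  have hprod := ((hlin.const_mul Complex.I).cexp).mul hf'
  refine hprod.deriv.trans ?_
  simp [wave]
  ring

theorem pderiv_wave_zero (α : Fin 2 → ℝ) (j : Fin 2 → ℤ) {f : ℝ → ℂ} (hf : ContDiff ℝ ∞ f)
    (x : Fin 3 → ℝ) :
    pderiv 0 (wave α j f) x = Complex.I * ((j 0 - α 0 : ℝ) : ℂ) * wave α j f x := by
  rw [pderiv, fderiv_wave α j hf]
  simp

theorem pderiv_wave_one (α : Fin 2 → ℝ) (j : Fin 2 → ℤ) {f : ℝ → ℂ} (hf : ContDiff ℝ ∞ f)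
    (x : Fin 3 → ℝ) :
    pderiv 1 (wave α j f) x = Complex.I * ((j 1 - α 1 : ℝ) : ℂ) * wave α j f x := by
  rw [pderiv, fderiv_wave α j hf]
  simp

theorem pderiv_wave_two (α : Fin 2 → ℝ) (j : Fin 2 → ℤ) {f : ℝ → ℂ} (hf : ContDiff ℝ ∞ f)
    (x : Fin 3 → ℝ) : pderiv 2 (wave α j f) x = wave α j (deriv f) x := by
  rw [pderiv, fderiv_wave α j hf]
  simp

theorem mode_eq_wave (α : Fin 2 → ℝ) (R : ℝ) (n : Fin 3 → ℤ) :
    mode α R n = wave α ![n 0, n 1] fun t =>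
      Complex.exp (Complex.I * ((2 * Real.pi * n 2 / R : ℝ) : ℂ) * t) := by
  funext x
  unfold mode wave
  rw [← Complex.exp_add]
  congr 1
  simp
  ring

theorem contDiff_cexp_mul (c : ℂ) : ContDiff ℝ ∞ fun t : ℝ => Complex.exp (c * t) :=
  (contDiff_const.mul Complex.ofRealCLM.contDiff).cexp

theorem deriv_cexp_mul (c : ℂ) :
    deriv (fun t : ℝ => Complex.exp (c * t)) = fun t : ℝ => c * Complex.exp (c * t) := by
  funext t
  have h : HasDerivAt (fun t : ℝ => Complex.exp (c * t)) (Complex.exp (c * t) * (c * 1)) t :=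
    (((hasDerivAt_id (t : ℂ)).const_mul c).cexp).comp_ofReal
  rw [h.deriv]
  ring

theorem isSmoothQP_mode (α : Fin 2 → ℝ) (R : ℝ) (n : Fin 3 → ℤ) : IsSmoothQP α (mode α R n) := by
  rw [mode_eq_wave]
  exact isSmoothQP_wave _ _ (contDiff_cexp_mul _)

/-! ### Pairings as inner products, and vanishing by Fourier coefficients. -/

theorem pair_eq_inner {X F : Type*} [MeasurableSpace X] {μ : Measure X} [NormedAddCommGroup F]
    [InnerProductSpace ℂ F] {f : X → F} (hf : MemLp f 2 μ) (u : Lp F 2 μ) :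
    ∫ x, inner ℂ (f x) (u x) ∂μ = inner ℂ (hf.toLp f) u := by
  rw [L2.inner_def]
  refine integral_congr_ae ?_
  filter_upwards [hf.coeFn_toLp] with x hx
  rw [hx]

theorem spair_eq_inner {X : Type*} [MeasurableSpace X] {μ : Measure X} {f : X → ℂ}
    (hf : MemLp f 2 μ) (u : Lp ℂ 2 μ) :
    ∫ x, conj (f x) * u x ∂μ = inner ℂ (hf.toLp f) u := by
  rw [← pair_eq_inner]
  simp [mul_comm]

theorem norm_sq_eq_integral {X F : Type*} [MeasurableSpace X] {μ : Measure X}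
    [NormedAddCommGroup F] [InnerProductSpace ℂ F] (u : Lp F 2 μ) :
    ‖u‖ ^ 2 = ∫ x, ‖u x‖ ^ 2 ∂μ := by
  have h : ((‖u‖ ^ 2 : ℝ) : ℂ) = ((∫ x, ‖u x‖ ^ 2 ∂μ : ℝ) : ℂ) := by
    rw [Complex.ofReal_pow]
    have h1 := inner_self_eq_norm_sq_to_K (𝕜 := ℂ) u
    rw [L2.inner_def] at h1
    refine h1.symm.trans ?_
    rw [← integral_complex_ofReal]
    refine integral_congr_ae (.of_forall fun x => ?_)
    simp [inner_self_eq_norm_sq_to_K]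
  exact_mod_cast h

theorem memLp_component {X : Type*} [MeasurableSpace X] {μ : Measure X} {n : ℕ}
    {u : X → CVec n} (hu : MemLp u 2 μ) (k : Fin n) : MemLp (fun x => u x k) 2 μ := by
  refine hu.of_le ((PiLp.continuous_apply 2 _ k).comp_aestronglyMeasurable hu.1)
    (.of_forall fun x => PiLp.norm_apply_le _ _)

/-- A square integrable function that is orthogonal to all exponentials vanishes. -/
theorem ae_eq_zero_of_mode {α : Fin 2 → ℝ} {R : ℝ} (hR : 0 < R) {v : (Fin 3 → ℝ) → ℂ}
    (hv : MemLp v 2 (volume.restrict (cell R)))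
    (h : ∀ n, ∫ x in cell R, conj (mode α R n x) * v x = 0) :
    v =ᵐ[volume.restrict (cell R)] 0 := by
  have h1 := hasSum_sq_mode α hR hv
  simp only [h, norm_zero, ne_eq, OfNat.ofNat_ne_zero, not_false_eq_true, zero_pow] at h1
  have h2 := h1.unique hasSum_zero
  have h3 : ∫ x in cell R, ‖v x‖ ^ 2 = 0 :=
    (mul_eq_zero.1 h2).resolve_left (cellVol_pos hR).ne'
  rw [integral_eq_zero_iff_of_nonneg (fun x => by positivity) hv.integrable_norm_pow'] at h3
  filter_upwards [h3] with x hx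
  simpa using hx

theorem field_eq_zero_of_mode {α : Fin 2 → ℝ} {R : ℝ} (hR : 0 < R) {u : L2Field R}
    (h : ∀ n k, ∫ x in cell R, conj (mode α R n x) * u x k = 0) : u = 0 := by
  have h1 : ∀ k, (fun x => u x k) =ᵐ[volume.restrict (cell R)] 0 := fun k =>
    ae_eq_zero_of_mode hR (memLp_component (Lp.memLp u) k) fun n => h n k
  refine Lp.ext ?_
  filter_upwards [h1 0, h1 1, h1 2, Lp.coeFn_zero (CVec 3) 2 (volume.restrict (cell R))]
    with x h0 h1 h2 hz
  rw [hz]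
  ext k
  fin_cases k
  · exact h0
  · exact h1
  · exact h2

/-! ### Poincaré's inequality and completeness of `W₀`. -/

/-- Green's formula for one partial derivative of an element of `W₀`. -/
theorem W₀.integral_pderiv {α : Fin 2 → ℝ} {R : ℝ} {p : WithLp 2 (L2Scalar R × L2Field R)}
    (hp : p ∈ W₀ α R) {φ : (Fin 3 → ℝ) → ℂ} (hφ : IsSmoothQP α φ) (k : Fin 3) :
    ∫ x in cell R, conj (φ x) * p.snd x k = -∫ x in cell R, conj (pderiv k φ x) * p.fst x := by
  have h := hp _ (isSmoothQP_single hφ k)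
  simp only [EuclideanSpace.inner_single_left, div_single, Pi.zero_apply, mul_zero,
    integral_zero, sub_zero] at h
  exact eq_neg_of_add_eq_zero_left h

/-- **Poincaré's inequality** in `W₀`. -/
theorem W₀.poincare {α : Fin 2 → ℝ} {R : ℝ} (hR : 0 < R)
    {p : WithLp 2 (L2Scalar R × L2Field R)} (hp : p ∈ W₀ α R) :
    ‖p.fst‖ ^ 2 ≤ 2 * R ^ 2 * ‖p.snd‖ ^ 2 := by
  have hpi := Real.pi_gt_three
  have hG := memLp_component (Lp.memLp p.snd) 2
  have hxG : MemLp (fun x => (x 2 : ℂ) * p.snd x 2) 2 (volume.restrict (cell R)) := by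
    refine hG.of_le_mul (c := R) ((Continuous.aestronglyMeasurable (by fun_prop)).mul hG.1) ?_
    filter_upwards [ae_restrict_mem (measurableSet_cell R)] with x hx
    rw [norm_mul, Complex.norm_real, Real.norm_eq_abs, abs_of_pos hx.2.2.1]
    exact mul_le_mul_of_nonneg_right hx.2.2.2.le (norm_nonneg _)
  have s0 := hasSum_sq_mode α hR (Lp.memLp p.fst)
  have s1 := hasSum_sq_mode α hR hG
  have s2 := hasSum_sq_mode α hR hxG
  -- The first term on the right serves the modes that oscillate vertically, the second those with
  -- `n 2 = 0`.
  have hle : ∀ n : Fin 3 → ℤ, ‖∫ x in cell R, conj (mode α R n x) * p.fst x‖ ^ 2 ≤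
      R ^ 2 * ‖∫ x in cell R, conj (mode α R n x) * p.snd x 2‖ ^ 2 +
        ‖∫ x in cell R, conj (mode α R n x) * ((x 2 : ℂ) * p.snd x 2)‖ ^ 2 := by
    intro n
    by_cases hn : n 2 = 0
    -- The vertical derivative of this mode is zero and gives no information. The test function is
    -- instead `x 2` times the mode, whose vertical derivative is the mode itself; it need not
    -- vanish at height `R` since `w` does.
    · have hsm : ContDiff ℝ ∞ fun t : ℝ => (t : ℂ) := Complex.ofRealCLM.contDiff
      have h := W₀.integral_pderiv hp (isSmoothQP_wave α ![n 0, n 1] hsm) 2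
      simp only [pderiv_wave_two α _ hsm] at h
      have hd : deriv (fun t : ℝ => (t : ℂ)) = fun _ => 1 := by
        funext t
        exact (hasDerivAt_id (t : ℂ)).comp_ofReal.deriv
      have e1 : wave α ![n 0, n 1] (deriv fun t : ℝ => (t : ℂ)) = mode α R n := by
        rw [hd, mode_eq_wave]
        simp [hn]
      have e2 : ∀ x, wave α ![n 0, n 1] (fun t : ℝ => (t : ℂ)) x = mode α R n x * (x 2 : ℂ) := by
        intro x
        rw [mode_eq_wave]
        simp [hn, wave]
      rw [e1] at h
      simp only [e2, map_mul, Complex.conj_ofReal, mul_assoc] at h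
      rw [h, norm_neg]
      nlinarith [sq_nonneg (R * ‖∫ x in cell R, conj (mode α R n x) * p.snd x 2‖)]
    · have h := W₀.integral_pderiv hp (isSmoothQP_mode α R n) 2
      have hd : ∀ x, pderiv 2 (mode α R n) x =
          Complex.I * ((2 * Real.pi * n 2 / R : ℝ) : ℂ) * mode α R n x := by
        intro x
        rw [mode_eq_wave, pderiv_wave_two α _ (contDiff_cexp_mul _), deriv_cexp_mul]
        simp only [wave]
        ring
      simp only [hd, map_mul, Complex.conj_ofReal, Complex.conj_I, mul_assoc] at h
      rw [integral_const_mul, integral_const_mul] at h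
      rw [h, norm_neg, norm_mul, norm_mul, norm_neg, Complex.norm_I, one_mul, Complex.norm_real]
      have h1 : (1 : ℝ) ≤ |(n 2 : ℝ)| := by
        rw [← Int.cast_abs]
        exact_mod_cast Int.one_le_abs hn
      -- This is `2π |n 2| ≥ 1`: division by the vertical frequency costs at most a factor `R`.
      have h2 : 1 ≤ R * ‖2 * (Real.pi * (n 2 : ℝ)) / R‖ := by
        rw [norm_div, norm_mul, norm_mul, Real.norm_eq_abs, Real.norm_eq_abs, Real.norm_eq_abs,
          Real.norm_eq_abs, abs_of_pos hR, abs_of_pos (by positivity : 0 < Real.pi), abs_two]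
        field_simp
        nlinarith
      have h3 := mul_le_mul_of_nonneg_right (one_le_pow₀ h2 (n := 2))
        (sq_nonneg ‖∫ x in cell R, conj (mode α R n x) * p.fst x‖)
      rw [one_mul, ← mul_pow, mul_assoc, mul_pow] at h3
      exact h3.trans (le_add_of_nonneg_right (sq_nonneg _))
  have hsum := hasSum_le hle s0 ((s1.mul_left (R ^ 2)).add s2)
  have hint : ∀ {f : (Fin 3 → ℝ) → ℂ}, MemLp f 2 (volume.restrict (cell R)) →
      Integrable (fun x => ‖f x‖ ^ 2) (volume.restrict (cell R)) := fun hf =>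
    hf.integrable_norm_pow'
  have hcomp : ∫ x in cell R, ‖p.snd x 2‖ ^ 2 ≤ ‖p.snd‖ ^ 2 := by
    rw [norm_sq_eq_integral]
    refine integral_mono (hint hG) (Lp.memLp p.snd).integrable_norm_pow' fun x => ?_
    exact pow_le_pow_left₀ (norm_nonneg _) (PiLp.norm_apply_le _ _) 2
  have hmul : ∫ x in cell R, ‖(x 2 : ℂ) * p.snd x 2‖ ^ 2 ≤
      R ^ 2 * ∫ x in cell R, ‖p.snd x 2‖ ^ 2 := by
    rw [← integral_const_mul]
    refine integral_mono_ae (hint hxG) ((hint hG).const_mul _) ?_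
    filter_upwards [ae_restrict_mem (measurableSet_cell R)] with x hx
    rw [norm_mul, Complex.norm_real, Real.norm_eq_abs, abs_of_pos hx.2.2.1, mul_pow]
    exact mul_le_mul_of_nonneg_right (pow_le_pow_left₀ hx.2.2.1.le hx.2.2.2.le 2) (sq_nonneg _)
  have hV := cellVol_pos hR
  rw [norm_sq_eq_integral p.fst]
  refine le_of_mul_le_mul_left (hsum.trans ?_) hV
  -- Each of the two sums contributes `R ^ 2`, the second because `0 < x 2 < R` in the cell.
  nlinarith [mul_le_mul_of_nonneg_left hmul hV.le,
    mul_le_mul_of_nonneg_left hcomp (by positivity : 0 ≤ cellVol R * R ^ 2)]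

/-- With zero traces, each test field imposes the vanishing of one continuous functional. Closedness
makes `W₀` a Hilbert space, as the adjoint and Lax–Milgram require. -/
theorem isClosed_W₀ (α : Fin 2 → ℝ) (R : ℝ) :
    IsClosed (W₀ α R : Set (WithLp 2 (L2Scalar R × L2Field R))) := by
  have h : (W₀ α R : Set (WithLp 2 (L2Scalar R × L2Field R))) =
      ⋂ (Φ : (Fin 3 → ℝ) → CVec 3) (hΦ : IsSmoothQP α Φ),
        {p | inner ℂ ((memLp_cell hΦ.smooth.continuous R).toLp _) p.snd +
          inner ℂ ((memLp_cell (continuous_div hΦ.smooth) R).toLp _) p.fst = 0} := by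
    ext p
    simp only [mem_iInter]
    refine forall₂_congr fun Φ hΦ => ?_
    rw [mem_ofPred_eq, ← pair_eq_inner, ← spair_eq_inner]
    simp
  rw [h]
  refine isClosed_iInter fun Φ => isClosed_iInter fun hΦ => isClosed_eq ?_ continuous_const
  fun_prop

instance (α : Fin 2 → ℝ) (R : ℝ) : CompleteSpace (W₀ α R) :=
  (isClosed_W₀ α R).completeSpace_coe

/-! ### Curl and trace: determination by the field, and gradients in `X`. -/

/-- The vertical phase at height `R` is a multiple of `2π`, so the trace of a mode does not see `n
2`. -/
theorem mode_atHeight (α : Fin 2 → ℝ) {R : ℝ} (hR : 0 < R) (n : Fin 3 → ℤ) (y : Fin 2 → ℝ) :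
    mode α R n (atHeight R y) =
      Complex.exp (Complex.I * (((n 0 - α 0) * y 0 + (n 1 - α 1) * y 1 : ℝ) : ℂ)) := by
  unfold mode
  rw [Complex.exp_eq_exp_iff_exists_int]
  refine ⟨n 2, ?_⟩
  have : (R : ℂ) ≠ 0 := by exact_mod_cast hR.ne'
  simp [atHeight]
  field_simp

/-- An element of the solution space is determined by its field. -/
theorem X.eq_zero_of_fst {α : Fin 2 → ℝ} {R : ℝ} (hR : 0 < R) {p : Ambient R} (hp : p ∈ X α R)
    (h0 : p.fst = 0) : p = 0 := by
  obtain ⟨g, hg, hgj⟩ := hp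
  have key : ∀ (n : Fin 3 → ℤ) (k : Fin 3),
      ∫ x in cell R, conj (mode α R n x) * p.snd.fst x k =
        ∫ y in square,
          (conj ((EuclideanSpace.single k (mode α R n (atHeight R y)) : CVec 3) 1) * g y 0 -
            conj ((EuclideanSpace.single k (mode α R n (atHeight R y)) : CVec 3) 0) * g y 1) := by
    intro n k
    have h := hg _ (isSmoothQP_single (isSmoothQP_mode α R n) k)
    rw [h0, pair_zero] at h
    simp only [EuclideanSpace.inner_single_left, Pi.zero_apply, PiLp.zero_apply, mul_zero,
      sub_zero, integral_zero] at h
    exact h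
  have hzero : ∀ (n : Fin 3 → ℤ) (k : Fin 3),
      ∫ x in cell R, conj (mode α R n x) * p.snd.fst x k = 0 := by
    intro n k
    -- By `key` the coefficients of the curl are boundary integrals, hence constant in `n 2`.
    -- Parseval makes their squares summable over `n 2`, and a constant summable over `ℤ` is zero.
    have hinj : Function.Injective fun m : ℤ => (![n 0, n 1, m] : Fin 3 → ℤ) := fun a b hab => by
      simpa using congrFun hab 2
    have hs := ((hasSum_sq_mode α hR
      (memLp_component (Lp.memLp p.snd.fst) k)).summable.comp_injective hinj)
    have hconst : ((fun n : Fin 3 → ℤ => ‖∫ x in cell R, conj (mode α R n x) * p.snd.fst x k‖ ^ 2) ∘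
        fun m : ℤ => (![n 0, n 1, m] : Fin 3 → ℤ)) =
        fun _ => ‖∫ x in cell R, conj (mode α R n x) * p.snd.fst x k‖ ^ 2 := by
      funext m
      simp only [Function.comp_apply, key, mode_atHeight α hR]
      simp
    rw [hconst, summable_const_iff] at hs
    simpa using hs
  have hc : p.snd.fst = 0 := field_eq_zero_of_mode hR hzero
  have hcoeff : ∀ j, fourierCoeff α g j = 0 := by
    intro j
    -- The sign change matches the convention `exp (i (α + j)·y)` of `fourierCoeff`.
    have hexp : ∀ y : Fin 2 → ℝ, conj (mode α R ![-j 0, -j 1, 0] (atHeight R y)) =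
        Complex.exp (Complex.I * (((α 0 + j 0) * y 0 + (α 1 + j 1) * y 1 : ℝ) : ℂ)) := by
      intro y
      rw [mode_atHeight α hR, ← Complex.exp_conj]
      congr 1
      simp
      ring
    -- The boundary term is a cross product: direction `1` detects `g 0` and direction `0` detects
    -- `-g 1`.
    have h1 := (key ![-j 0, -j 1, 0] 1).symm.trans (hzero _ _)
    have h2 := (key ![-j 0, -j 1, 0] 0).symm.trans (hzero _ _)
    simp only [PiLp.single_apply, if_true, Fin.isValue, zero_ne_one, one_ne_zero, if_false,
      map_zero, zero_mul, sub_zero, zero_sub, hexp] at h1 h2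
    rw [integral_neg, neg_eq_zero] at h2
    have hcomp : ∀ k : Fin 2, (∫ y in square, Complex.exp (Complex.I *
        (((α 0 + j 0) * y 0 + (α 1 + j 1) * y 1 : ℝ) : ℂ)) • g y) k =
        ∫ y in square, Complex.exp (Complex.I *
        (((α 0 + j 0) * y 0 + (α 1 + j 1) * y 1 : ℝ) : ℂ)) * g y k := fun k =>
      ((EuclideanSpace.proj (𝕜 := ℂ) k).integral_comp_comm (integrable_fourier α g j)).symm
    unfold fourierCoeff
    rw [smul_eq_zero]
    right
    ext k
    rw [hcomp]
    fin_cases k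
    · exact h1
    · exact h2
  have hl : p.snd.snd = 0 := by
    ext1
    funext j
    rw [hgj, hcoeff, smul_zero]
    rfl
  have hs : p.snd = 0 := by
    refine (WithLp.equiv 2 _).injective (Prod.ext hc hl)
  exact (WithLp.equiv 2 _).injective (Prod.ext h0 hs)

/-- The gradients of functions in `W₀` belong to the solution space. -/
theorem W₀.gradient_mem_X {α : Fin 2 → ℝ} {R : ℝ} {p : WithLp 2 (L2Scalar R × L2Field R)}
    (hp : p ∈ W₀ α R) : (WithLp.toLp 2 (p.snd, 0) : Ambient R) ∈ X α R := by
  refine ⟨0, fun Φ hΦ => ?_, fun j => ?_⟩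
  -- Green's formula for `w`, tested with `curl Φ`, is the statement that `∇w` has zero curl and
  -- zero tangential traces.
  · have h := hp _ hΦ.curl
    simp only [div_curl hΦ.smooth, map_zero, zero_mul, integral_zero, add_zero, Pi.zero_apply,
      mul_zero, sub_zero] at h
    simp only [tangential_pair]
    rw [pair_zero]
    change (∫ x in cell R, inner ℂ (Φ x) ((0 : L2Field R) x)) -
      (∫ x in cell R, inner ℂ (curl Φ x) (p.snd x)) = _
    rw [pair_zero, h]
    simp
  · have : fourierCoeff α (0 : L2Tangential) j = 0 := by
      simpa using fourierCoeff_smul α 0 0 j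
    rw [this, smul_zero]
    rfl

/-! ### The coefficient as an operator, and Lax–Milgram. -/

/-- Multiplication by an essentially bounded coefficient on square integrable fields. -/
def mulCoeff {R : ℝ} {ε : (Fin 3 → ℝ) → ℂ} (hε : MemLp ε ⊤ (volume.restrict (cell R))) :
    L2Field R →L[ℂ] L2Field R :=
  (ContinuousLinearMap.lsmul ℂ ℂ).holderL (volume.restrict (cell R)) ⊤ 2 2 (hε.toLp ε)

theorem coeFn_mulCoeff {R : ℝ} {ε : (Fin 3 → ℝ) → ℂ}
    (hε : MemLp ε ⊤ (volume.restrict (cell R))) (u : L2Field R) :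
    mulCoeff hε u =ᵐ[volume.restrict (cell R)] fun x => ε x • u x := by
  have h := (ContinuousLinearMap.lsmul ℂ ℂ).coeFn_holder (r := 2) (hε.toLp ε) u
  filter_upwards [h, hε.coeFn_toLp] with x h1 h2
  rw [← h2]
  exact h1

theorem re_inner_mulCoeff {R : ℝ} {ε : (Fin 3 → ℝ) → ℂ}
    (hε : MemLp ε ⊤ (volume.restrict (cell R))) {ε₀ : ℝ}
    (hre : ∀ᵐ x ∂(volume.restrict (cell R)), ε₀ ≤ (ε x).re) (u : L2Field R) :
    ε₀ * ‖u‖ ^ 2 ≤ (inner ℂ u (mulCoeff hε u)).re := by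
  have hi := L2.integrable_inner (𝕜 := ℂ) u (mulCoeff hε u)
  rw [L2.inner_def, norm_sq_eq_integral, ← integral_const_mul]
  refine le_of_le_of_eq ?_ (integral_re hi)
  refine integral_mono_ae ((Lp.memLp u).integrable_norm_pow'.const_mul _) hi.re ?_
  filter_upwards [hre, coeFn_mulCoeff hε u] with x h1 h2
  rw [h2, inner_smul_right, inner_self_eq_norm_sq_to_K]
  have : ((ε x * ((‖u x‖ : ℝ) : ℂ) ^ 2).re) = (ε x).re * ‖u x‖ ^ 2 := by
    rw [← Complex.ofReal_pow, Complex.re_mul_ofReal]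
  exact (mul_le_mul_of_nonneg_right h1 (sq_nonneg _)).trans this.ge

/-- The **Lax–Milgram theorem** for a coercive bounded operator on a complex Hilbert space. -/
theorem bijective_of_coercive {V : Type*} [NormedAddCommGroup V] [InnerProductSpace ℂ V]
    [CompleteSpace V] (A : V →L[ℂ] V) {c : ℝ} (hc : 0 < c)
    (hA : ∀ v, c * ‖v‖ ^ 2 ≤ (inner ℂ v (A v)).re) : Function.Bijective A := by
  have hbelow : ∀ v, ‖v‖ ≤ c⁻¹ * ‖A v‖ := by
    intro v
    rw [inv_mul_eq_div, le_div_iff₀ hc]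
    have h1 := (hA v).trans ((Complex.re_le_norm _).trans (norm_inner_le_norm v (A v)))
    rcases (norm_nonneg v).eq_or_lt with h | h
    · rw [← h, zero_mul]
      exact norm_nonneg _
    · exact le_of_mul_le_mul_left (by linarith) h
  have hanti : AntilipschitzWith (c⁻¹).toNNReal A := by
    refine A.antilipschitz_of_bound fun v => ?_
    rw [Real.coe_toNNReal _ (inv_nonneg.2 hc.le)]
    exact hbelow v
  refine ⟨hanti.injective, ?_⟩
  -- The range is closed, so surjectivity reduces to a trivial orthogonal complement; a vector `v`
  -- orthogonal to `A v` is zero by coercivity.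
  have hcl : IsClosed (A.range : Set V) := hanti.isClosed_range A.uniformContinuous
  have := hcl.completeSpace_coe
  have htop : A.range = ⊤ := by
    rw [← Submodule.orthogonal_eq_bot_iff, Submodule.eq_bot_iff]
    intro v hv
    have h1 : inner ℂ v (A v) = 0 := by
      rw [← inner_conj_symm, hv (A v) ⟨v, rfl⟩, map_zero]
    have h2 := hA v
    rw [h1, Complex.zero_re] at h2
    have h3 : ‖v‖ ^ 2 ≤ 0 := nonpos_of_mul_nonpos_right h2 hc
    simpa using h3
  exact LinearMap.range_eq_top.1 htop

/-! ### Green's formula for smooth functions. -/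

/-- Green's formula on the cell for smooth quasi-periodic functions, one of which vanishes on the
horizontal faces. -/
theorem green {α : Fin 2 → ℝ} {R : ℝ} (hR : 0 < R) {φ : (Fin 3 → ℝ) → ℂ} (hφ : IsSmoothQP α φ)
    (h0 : ∀ y, φ (atHeight 0 y) = 0) (h1 : ∀ y, φ (atHeight R y) = 0)
    {Φ : (Fin 3 → ℝ) → CVec 3} (hΦ : IsSmoothQP α Φ) :
    (∫ x in cell R, inner ℂ (Φ x) (grad φ x)) + ∫ x in cell R, conj (div Φ x) * φ x = 0 := by
  have hpi := Real.pi_pos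
  have hprod : ∀ i, ContDiff ℝ ∞ fun x => conj (Φ x i) * φ x := fun i =>
    (Complex.conjCLE.contDiff.comp (contDiff_comp hΦ.smooth i)).mul hφ.smooth
  have hd : ∀ i x, fderiv ℝ (fun x => conj (Φ x i) * φ x) x (Pi.single i 1) =
      conj (Φ x i) * pderiv i φ x + conj (pderiv i (fun y => Φ y i) x) * φ x := by
    intro i x
    have e1 : HasFDerivAt φ (fderiv ℝ φ x) x :=
      (hφ.smooth.differentiable (by simp)).differentiableAt.hasFDerivAt
    have e2 : HasFDerivAt (fun y => Φ y i) (fderiv ℝ (fun y => Φ y i) x) x :=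
      ((contDiff_comp hΦ.smooth i).differentiable (by simp)).differentiableAt.hasFDerivAt
    have e3 := (Complex.conjCLE.hasFDerivAt.comp x e2).mul e1
    have e4 : fderiv ℝ (fun x => conj (Φ x i) * φ x) x = _ := e3.fderiv
    rw [e4]
    simp [pderiv]
    ring
  -- Conjugation inverts the phase of `Φ`, so the product is genuinely periodic.
  have hper : ∀ i (j : Fin 2 → ℤ) x, conj (Φ (x + period j) i) * φ (x + period j) =
      conj (Φ x i) * φ x := by
    intro i j x
    have h : Φ (x + period j) i = _ := (hΦ.comp i).quasiPeriodic j x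
    rw [hφ.quasiPeriodic, h, smul_eq_mul, smul_eq_mul, map_mul,
      ← Complex.exp_conj, mul_mul_mul_comm, ← Complex.exp_add]
    have h2 : conj (2 : ℂ) = 2 := Complex.conj_eq_iff_real.2 ⟨2, by simp⟩
    simp [h2]
  have hle : (![-Real.pi, -Real.pi, 0] : Fin 3 → ℝ) ≤ ![Real.pi, Real.pi, R] := by
    intro i
    fin_cases i <;> simp <;> linarith
  have hint : ∀ i, IntegrableOn
      (fun x => fderiv ℝ (fun x => conj (Φ x i) * φ x) x (Pi.single i 1))
      (Icc ![-Real.pi, -Real.pi, 0] ![Real.pi, Real.pi, R]) := fun i =>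
    (continuous_pderiv (hprod i) i).continuousOn.integrableOn_compact isCompact_Icc
  have hdiv := integral_divergence_of_hasFDerivAt_off_countable' _ _ hle
    (fun i x => conj (Φ x i) * φ x) (fun i x => fderiv ℝ (fun x => conj (Φ x i) * φ x) x) ∅
    countable_empty (fun i => (hprod i).continuous.continuousOn)
    (fun x _ i => ((hprod i).differentiable (by simp)).differentiableAt.hasFDerivAt)
    (integrable_finsetSum _ fun i _ => hint i)
  have hlat : ∀ (i : Fin 3) (a b : ℝ) (j : Fin 2 → ℤ) (y : Fin 2 → ℝ),
      i.insertNth b y = i.insertNth a y + period j →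
      (conj (Φ (i.insertNth b y) i) * φ (i.insertNth b y) : ℂ) =
        conj (Φ (i.insertNth a y) i) * φ (i.insertNth a y) := by
    intro i a b j y h
    rw [h, hper]
  have hz : ∀ (h : ℝ) (y : Fin 2 → ℝ), (2 : Fin 3).insertNth h y = atHeight h y := by
    intro h y
    ext i
    fin_cases i <;> rfl
  have hcell : ∀ f : (Fin 3 → ℝ) → ℂ, ∫ x in cell R, f x =
      ∫ x in Icc ![-Real.pi, -Real.pi, 0] ![Real.pi, Real.pi, R], f x := by
    intro f
    refine setIntegral_congr_set ?_
    rw [cell_eq_pi]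
    exact Measure.univ_pi_Ioo_ae_eq_Icc (μ := fun _ : Fin 3 => (volume : Measure ℝ))
  -- In the divergence theorem opposite lateral faces cancel by periodicity, and the horizontal
  -- faces vanish because `φ` does.
  have hrhs : (∫ x in Icc ![-Real.pi, -Real.pi, 0] ![Real.pi, Real.pi, R],
      ∑ i : Fin 3, fderiv ℝ (fun x => conj (Φ x i) * φ x) x (Pi.single i 1)) = 0 := by
    rw [hdiv]
    refine Finset.sum_eq_zero fun i _ => ?_
    rw [sub_eq_zero]
    refine integral_congr_ae (.of_forall fun y => ?_)
    fin_cases i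
    · refine hlat 0 _ _ ![1, 0] y ?_
      ext i
      refine Fin.cases ?_ (fun i => ?_) i
      · simp [period]
        ring
      · fin_cases i
        · simp [period]
        · simp [period]
          rfl
    · refine hlat 1 _ _ ![0, 1] y ?_
      ext i
      fin_cases i
      · simp [period, Fin.insertNth, Fin.succAboveCases]
      · simp [period]
        ring
      · simp [period]
        rfl
    · change conj (Φ ((2 : Fin 3).insertNth R y) 2) * φ ((2 : Fin 3).insertNth R y) =
        conj (Φ ((2 : Fin 3).insertNth 0 y) 2) * φ ((2 : Fin 3).insertNth 0 y)
      rw [hz, hz, h0, h1, mul_zero, mul_zero]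
  have i1 : Integrable (fun x => inner ℂ (Φ x) (grad φ x)) (volume.restrict (cell R)) :=
    (memLp_one_iff_integrable.1 ((memLp_cell (hΦ.smooth.continuous.inner
      (continuous_grad hφ.smooth)) R).mono_exponent (by norm_num)))
  have i2 : Integrable (fun x => conj (div Φ x) * φ x) (volume.restrict (cell R)) :=
    (memLp_one_iff_integrable.1 ((memLp_cell ((Complex.continuous_conj.comp
      (continuous_div hΦ.smooth)).mul hφ.smooth.continuous) R).mono_exponent (by norm_num)))
  rw [← integral_add i1 i2, hcell, ← hrhs]
  refine integral_congr_ae (.of_forall fun x => ?_)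
  simp only [hd, Fin.sum_univ_three, PiLp.inner_apply, grad, div, RCLike.inner_apply, map_add]
  simp
  ring

/-! ### Cutoff near the horizontal faces. -/

/-- A smooth step from `0` on `(-∞, 1]` to `1` on `[2, ∞)`. -/
def step (t : ℝ) : ℝ := Real.smoothTransition (t - 1)

theorem contDiff_step : ContDiff ℝ ∞ step :=
  Real.smoothTransition.contDiff.comp (contDiff_id.sub contDiff_const)

theorem step_of_le {t : ℝ} (ht : t ≤ 1) : step t = 0 :=
  Real.smoothTransition.zero_of_nonpos (by linarith)

theorem step_of_ge {t : ℝ} (ht : 2 ≤ t) : step t = 1 :=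
  Real.smoothTransition.one_of_one_le (by linarith)

theorem abs_step_le (t : ℝ) : |step t| ≤ 1 := by
  rw [step, abs_of_nonneg (Real.smoothTransition.nonneg _)]
  exact Real.smoothTransition.le_one _

theorem deriv_step_of_lt {t : ℝ} (ht : t < 1) : deriv step t = 0 := by
  have h : step =ᶠ[nhds t] fun _ => 0 := by
    filter_upwards [Iio_mem_nhds ht] with s hs
    exact step_of_le (le_of_lt hs)
  rw [h.deriv_eq, deriv_const]

theorem deriv_step_of_gt {t : ℝ} (ht : 2 < t) : deriv step t = 0 := by
  have h : step =ᶠ[nhds t] fun _ => 1 := by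
    filter_upwards [Ioi_mem_nhds ht] with s hs
    exact step_of_ge (le_of_lt hs)
  rw [h.deriv_eq, deriv_const]

/-- The derivative lives on `[1, 2]`. The product `t * deriv step t` is scale invariant, so one
bound serves the cutoffs at every scale. -/
theorem exists_bound_mul_deriv_step : ∃ M : ℝ, ∀ t, |t * deriv step t| ≤ M := by
  have hc : Continuous fun t => t * deriv step t :=
    continuous_id.mul (contDiff_step.continuous_deriv (by simp))
  obtain ⟨M, hM⟩ := (isCompact_Icc (a := (1 : ℝ)) (b := 2)).exists_bound_of_continuousOn
    hc.continuousOn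
  have hM0 : 0 ≤ M := (norm_nonneg _).trans (hM 1 (by norm_num))
  refine ⟨M, fun t => ?_⟩
  rcases lt_or_ge t 1 with h | h
  · rwa [deriv_step_of_lt h, mul_zero, abs_zero]
  rcases lt_or_ge 2 t with h' | h'
  · rwa [deriv_step_of_gt h', mul_zero, abs_zero]
  · exact hM t ⟨h, h'⟩

/-- A smooth function that vanishes at the ends of an interval is approximated, together with its
derivative, by smooth functions with support inside the interval. -/
theorem exists_cutoff {R : ℝ} (hR : 0 < R) {f : ℝ → ℂ} (hf : ContDiff ℝ ∞ f) (h0 : f 0 = 0)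
    (h1 : f R = 0) : ∃ (F : ℕ → ℝ → ℂ) (C : ℝ), (∀ n, ContDiff ℝ ∞ (F n)) ∧
      (∀ n, ∃ a b : ℝ, 0 < a ∧ b < R ∧ ∀ t, F n t ≠ 0 → t ∈ Icc a b) ∧
      (∀ n, ∀ t ∈ Ioo 0 R, ‖F n t‖ ≤ C ∧ ‖deriv (F n) t‖ ≤ C) ∧
      ∀ t ∈ Ioo 0 R, ∀ᶠ n in Filter.atTop, F n t = f t ∧ deriv (F n) t = deriv f t := by
  obtain ⟨M, hM⟩ := exists_bound_mul_deriv_step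
  have hM0 : 0 ≤ M := (abs_nonneg _).trans (hM 0)
  obtain ⟨C₁, hC₁⟩ := (isCompact_Icc (a := (0 : ℝ)) (b := R)).exists_bound_of_continuousOn
    hf.continuous.continuousOn
  obtain ⟨C₂, hC₂⟩ := (isCompact_Icc (a := (0 : ℝ)) (b := R)).exists_bound_of_continuousOn
    (hf.continuous_deriv (by simp)).continuousOn
  have hC₁0 : 0 ≤ C₁ := (norm_nonneg _).trans (hC₁ 0 ⟨le_rfl, hR.le⟩)
  have hC₂0 : 0 ≤ C₂ := (norm_nonneg _).trans (hC₂ 0 ⟨le_rfl, hR.le⟩)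
  have hdiff : ∀ t, DifferentiableAt ℝ f t := fun t => (hf.differentiable (by simp)).differentiableAt
  have hleft : ∀ t ∈ Icc 0 R, ‖f t‖ ≤ C₂ * t := by
    intro t ht
    have := (convex_Icc 0 R).norm_image_sub_le_of_norm_deriv_le (fun x _ => hdiff x) hC₂
      (left_mem_Icc.2 hR.le) ht
    rwa [h0, sub_zero, sub_zero, Real.norm_eq_abs, abs_of_nonneg ht.1] at this
  have hright : ∀ t ∈ Icc 0 R, ‖f t‖ ≤ C₂ * (R - t) := by
    intro t ht
    have := (convex_Icc 0 R).norm_image_sub_le_of_norm_deriv_le (fun x _ => hdiff x) hC₂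
      ht (right_mem_Icc.2 hR.le)
    rwa [h1, zero_sub, norm_neg, Real.norm_eq_abs, abs_of_nonneg (by linarith [ht.2])] at this
  have hχ : ∀ n : ℕ, ContDiff ℝ ∞ fun t : ℝ => step ((n + 1) * t) * step ((n + 1) * (R - t)) :=
    fun n => (contDiff_step.comp (contDiff_const.mul contDiff_id)).mul
      (contDiff_step.comp (contDiff_const.mul (contDiff_const.sub contDiff_id)))
  have hstep : ∀ t, HasDerivAt step (deriv step t) t := fun t =>
    (contDiff_step.differentiable (by simp)).differentiableAt.hasDerivAt
  have hderiv : ∀ (n : ℕ) t, HasDerivAt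
      (fun t : ℝ => f t * ((step ((n + 1) * t) * step ((n + 1) * (R - t)) : ℝ) : ℂ))
      (deriv f t * ((step ((n + 1) * t) * step ((n + 1) * (R - t)) : ℝ) : ℂ) +
        f t * (((deriv step ((n + 1) * t) * (n + 1)) * step ((n + 1) * (R - t)) +
          step ((n + 1) * t) * (deriv step ((n + 1) * (R - t)) * -(n + 1)) : ℝ) : ℂ)) t := by
    intro n t
    have e1 : HasDerivAt (fun t : ℝ => ((n : ℝ) + 1) * t) (n + 1) t := by
      simpa using (hasDerivAt_id t).const_mul ((n : ℝ) + 1)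
    have e2 : HasDerivAt (fun t : ℝ => ((n : ℝ) + 1) * (R - t)) (-(n + 1)) t := by
      simpa using ((hasDerivAt_id t).const_sub R).const_mul ((n : ℝ) + 1)
    have e3 := ((hstep _).comp t e1).mul ((hstep _).comp t e2)
    exact (hdiff t).hasDerivAt.mul e3.ofReal_comp
  have hprod : ∀ a b : ℝ, |step a * step b| ≤ 1 := fun a b => by
    rw [abs_mul]
    exact mul_le_one₀ (abs_step_le a) (abs_nonneg _) (abs_step_le b)
  -- The slope `n + 1` of the cutoff is compensated by the linear decay of `f` at the distance `s`
  -- from the face. This is where `f 0 = f R = 0` matters.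
  have hbd : ∀ (z : ℂ) (s : ℝ) (n : ℕ), 0 < s → ‖z‖ ≤ C₂ * s →
      ‖z‖ * |deriv step ((n + 1) * s) * (n + 1)| ≤ C₂ * M := by
    intro z s n hs hz
    calc ‖z‖ * |deriv step ((n + 1) * s) * (n + 1)|
        ≤ C₂ * s * |deriv step ((n + 1) * s) * (n + 1)| :=
          mul_le_mul_of_nonneg_right hz (abs_nonneg _)
      _ = C₂ * |(n + 1) * s * deriv step ((n + 1) * s)| := by
          rw [abs_mul, abs_mul, abs_mul, abs_of_pos hs]
          ring
      _ ≤ C₂ * M := mul_le_mul_of_nonneg_left (hM _) hC₂0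
  refine ⟨fun n t => f t * ((step ((n + 1) * t) * step ((n + 1) * (R - t)) : ℝ) : ℂ),
    C₁ + (C₂ + (C₂ * M + C₂ * M)), fun n => ?_, fun n => ?_, fun n t ht => ⟨?_, ?_⟩, fun t ht => ?_⟩
  · exact hf.mul (Complex.ofRealCLM.contDiff.comp (hχ n))
  · have hn : (0 : ℝ) < n + 1 := by positivity
    refine ⟨1 / (n + 1), R - 1 / (n + 1), by positivity, by linarith [one_div_pos.2 hn],
      fun t ht => ⟨?_, ?_⟩⟩
    · by_contra h
      rw [not_le, lt_div_iff₀' hn] at h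
      simp [step_of_le h.le] at ht
    · by_contra h
      have h' : R - t < 1 / (n + 1) := by linarith
      rw [lt_div_iff₀' hn] at h'
      simp [step_of_le h'.le] at ht
  · rw [norm_mul, Complex.norm_real, Real.norm_eq_abs]
    have := mul_le_mul (hC₁ t ⟨ht.1.le, ht.2.le⟩) (hprod ((n + 1) * t) ((n + 1) * (R - t)))
      (abs_nonneg _) hC₁0
    nlinarith [mul_nonneg hC₂0 hM0]
  · rw [(hderiv n t).deriv]
    have b1 : ‖deriv f t * ((step ((n + 1) * t) * step ((n + 1) * (R - t)) : ℝ) : ℂ)‖ ≤ C₂ := by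
      rw [norm_mul, Complex.norm_real, Real.norm_eq_abs]
      have := mul_le_mul (hC₂ t ⟨ht.1.le, ht.2.le⟩) (hprod ((n + 1) * t) ((n + 1) * (R - t)))
        (abs_nonneg _) hC₂0
      linarith
    have b2 := hbd (f t) t n ht.1 (hleft t ⟨ht.1.le, ht.2.le⟩)
    have b3 := hbd (f t) (R - t) n (by linarith [ht.2]) (hright t ⟨ht.1.le, ht.2.le⟩)
    have b4 : |deriv step ((n + 1) * t) * (n + 1) * step ((n + 1) * (R - t)) +
        step ((n + 1) * t) * (deriv step ((n + 1) * (R - t)) * -(n + 1))| ≤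
        |deriv step ((n + 1) * t) * (n + 1)| + |deriv step ((n + 1) * (R - t)) * (n + 1)| := by
      refine (abs_add_le _ _).trans (add_le_add ?_ ?_)
      · rw [abs_mul]
        exact mul_le_of_le_one_right (abs_nonneg _) (abs_step_le _)
      · rw [abs_mul, mul_neg, abs_neg]
        exact mul_le_of_le_one_left (abs_nonneg _) (abs_step_le _)
    refine (norm_add_le _ _).trans ((add_le_add b1 ?_).trans (le_add_of_nonneg_left hC₁0))
    rw [norm_mul, Complex.norm_real, Real.norm_eq_abs]
    refine (mul_le_mul_of_nonneg_left b4 (norm_nonneg _)).trans ?_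
    rw [mul_add]
    exact add_le_add b2 b3
  -- The strict inequality puts `t` where both steps are locally constant, so the derivatives agree
  -- as well.
  · have hbig : ∀ s : ℝ, 0 < s → ∀ᶠ n : ℕ in Filter.atTop, 2 < ((n : ℝ) + 1) * s := by
      intro s hs
      have := (Filter.tendsto_atTop_add_const_right Filter.atTop (1 : ℝ)
        tendsto_natCast_atTop_atTop).atTop_mul_const hs
      exact this.eventually_gt_atTop 2
    filter_upwards [hbig t ht.1, hbig (R - t) (by linarith [ht.2])] with n hn1 hn2
    rw [(hderiv n t).deriv, step_of_ge hn1.le, step_of_ge hn2.le, deriv_step_of_gt hn1,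
      deriv_step_of_gt hn2]
    simp

/-! ### Density in `W₀` of the functions vanishing near the faces. -/

/-- A smooth quasi-periodic function together with its gradient. -/
def smoothPair {α : Fin 2 → ℝ} (R : ℝ) {φ : (Fin 3 → ℝ) → ℂ} (hφ : IsSmoothQP α φ) :
    WithLp 2 (L2Scalar R × L2Field R) :=
  WithLp.toLp 2 ((memLp_cell hφ.smooth.continuous R).toLp φ,
    (memLp_cell (continuous_grad hφ.smooth) R).toLp (grad φ))

/-- The functions that vanish near the heights `0` and `R`. -/
def VanishesNearFaces (R : ℝ) (φ : (Fin 3 → ℝ) → ℂ) : Prop :=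
  ∃ a b : ℝ, 0 < a ∧ b < R ∧ ∀ x, φ x ≠ 0 → x 2 ∈ Icc a b

theorem smoothPair_mem {α : Fin 2 → ℝ} {R : ℝ} (hR : 0 < R) {φ : (Fin 3 → ℝ) → ℂ}
    (hφ : IsSmoothQP α φ) (hs : VanishesNearFaces R φ) : smoothPair R hφ ∈ W₀ α R := by
  obtain ⟨a, b, ha, hb, hab⟩ := hs
  have h0 : ∀ y, φ (atHeight 0 y) = 0 := fun y => by
    by_contra h
    have := (hab _ h).1
    simp [atHeight] at this
    linarith
  have h1 : ∀ y, φ (atHeight R y) = 0 := fun y => by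
    by_contra h
    have := (hab _ h).2
    simp [atHeight] at this
    linarith
  intro Φ hΦ
  have hg := green hR hφ h0 h1 hΦ
  have e1 : ∫ x in cell R, inner ℂ (Φ x) ((smoothPair R hφ).snd x) =
      ∫ x in cell R, inner ℂ (Φ x) (grad φ x) := by
    refine integral_congr_ae ?_
    filter_upwards [(memLp_cell (continuous_grad hφ.smooth) R).coeFn_toLp] with x hx
    rw [← hx]
    rfl
  have e2 : ∫ x in cell R, conj (div Φ x) * (smoothPair R hφ).fst x =
      ∫ x in cell R, conj (div Φ x) * φ x := by
    refine integral_congr_ae ?_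
    filter_upwards [(memLp_cell hφ.smooth.continuous R).coeFn_toLp] with x hx
    rw [← hx]
    rfl
  rw [e1, e2, hg]
  simp

theorem inner_smoothPair {α : Fin 2 → ℝ} {R : ℝ} {φ : (Fin 3 → ℝ) → ℂ} (hφ : IsSmoothQP α φ)
    (p : WithLp 2 (L2Scalar R × L2Field R)) : inner ℂ (smoothPair R hφ) p =
      (∫ x in cell R, conj (φ x) * p.fst x) + ∫ x in cell R, inner ℂ (grad φ x) (p.snd x) := by
  rw [spair_eq_inner (memLp_cell hφ.smooth.continuous R),
    pair_eq_inner (memLp_cell (continuous_grad hφ.smooth) R), WithLp.prod_inner_apply]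
  rfl

theorem norm_wave (α : Fin 2 → ℝ) (j : Fin 2 → ℤ) (f : ℝ → ℂ) (x : Fin 3 → ℝ) :
    ‖wave α j f x‖ = ‖f (x 2)‖ := by
  rw [wave, norm_mul, mul_comm Complex.I, Complex.norm_exp_ofReal_mul_I, one_mul]

theorem inner_grad (φ : (Fin 3 → ℝ) → ℂ) (x : Fin 3 → ℝ) (v : CVec 3) :
    inner ℂ (grad φ x) v =
      conj (pderiv 0 φ x) * v 0 + conj (pderiv 1 φ x) * v 1 + conj (pderiv 2 φ x) * v 2 := by
  simp only [PiLp.inner_apply, Fin.sum_univ_three, RCLike.inner_apply, grad]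
  simp
  ring

/-- If an element is orthogonal to all smooth functions that vanish near the faces, then it is
orthogonal to the waves that only vanish on the faces. -/
theorem inner_wave_eq_zero {α : Fin 2 → ℝ} {R : ℝ} (hR : 0 < R)
    {p : WithLp 2 (L2Scalar R × L2Field R)}
    (hp : ∀ (φ : (Fin 3 → ℝ) → ℂ) (hφ : IsSmoothQP α φ), VanishesNearFaces R φ →
      inner ℂ (smoothPair R hφ) p = 0)
    (j : Fin 2 → ℤ) {f : ℝ → ℂ} (hf : ContDiff ℝ ∞ f) (h0 : f 0 = 0) (h1 : f R = 0) :
    inner ℂ (smoothPair R (isSmoothQP_wave α j hf)) p = 0 := by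
  obtain ⟨F, C, hF, hsupp, hbd, hlim⟩ := exists_cutoff hR hf h0 h1
  have i1 : ∀ {g : ℝ → ℂ} (_ : ContDiff ℝ ∞ g),
      Integrable (fun x => conj (wave α j g x) * p.fst x) (volume.restrict (cell R)) := by
    intro g hg
    refine (integrable_pair (memLp_cell (isSmoothQP_wave α j hg).smooth.continuous R) p.fst).congr
      (.of_forall fun x => ?_)
    simp [mul_comm]
  have i2 : ∀ {g : ℝ → ℂ} (_ : ContDiff ℝ ∞ g),
      Integrable (fun x => inner ℂ (grad (wave α j g) x) (p.snd x)) (volume.restrict (cell R)) :=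
    fun hg => integrable_pair
      (memLp_cell (continuous_grad (isSmoothQP_wave α j hg).smooth) R) p.snd
  have hsum : ∀ {g : ℝ → ℂ} (hg : ContDiff ℝ ∞ g),
      inner ℂ (smoothPair R (isSmoothQP_wave α j hg)) p =
        ∫ x in cell R, (conj (wave α j g x) * p.fst x +
          inner ℂ (grad (wave α j g) x) (p.snd x)) := by
    intro g hg
    rw [inner_smoothPair, integral_add (i1 hg) (i2 hg)]
  have hzero : ∀ n, inner ℂ (smoothPair R (isSmoothQP_wave α j (hF n))) p = 0 := by
    intro n
    obtain ⟨a, b, ha, hb, hab⟩ := hsupp n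
    exact hp _ _ ⟨a, b, ha, hb, fun x hx => hab _ (right_ne_zero_of_mul hx)⟩
  have htend : Filter.Tendsto (fun n => ∫ x in cell R, (conj (wave α j (F n) x) * p.fst x +
      inner ℂ (grad (wave α j (F n)) x) (p.snd x))) Filter.atTop
      (nhds (∫ x in cell R, (conj (wave α j f x) * p.fst x +
        inner ℂ (grad (wave α j f) x) (p.snd x)))) := by
    -- The bounds of `exists_cutoff` are uniform in `n`, and at each point of the cell the
    -- integrands are eventually equal to the limit.
    refine tendsto_integral_of_dominated_convergence
      (fun x => C * ‖p.fst x‖ +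
        (|j 0 - α 0| * C * ‖p.snd x‖ + |j 1 - α 1| * C * ‖p.snd x‖ + C * ‖p.snd x‖))
      (fun n => ((i1 (hF n)).add (i2 (hF n))).1) ?_ (fun n => ?_) ?_
    · have j1 : Integrable (fun x => ‖p.fst x‖) (volume.restrict (cell R)) :=
        ((Lp.memLp p.fst).integrable (by norm_num)).norm
      have j2 : Integrable (fun x => ‖p.snd x‖) (volume.restrict (cell R)) :=
        ((Lp.memLp p.snd).integrable (by norm_num)).norm
      exact (j1.const_mul _).add (((j2.const_mul _).add (j2.const_mul _)).add (j2.const_mul _))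
    · filter_upwards [ae_restrict_mem (measurableSet_cell R)] with x hx
      obtain ⟨hb1, hb2⟩ := hbd n (x 2) hx.2.2
      have hC0 : 0 ≤ C := (norm_nonneg _).trans hb1
      refine (norm_add_le _ _).trans (add_le_add ?_ ?_)
      · rw [norm_mul, RCLike.norm_conj, norm_wave]
        exact mul_le_mul_of_nonneg_right hb1 (norm_nonneg _)
      · rw [inner_grad, pderiv_wave_zero α j (hF n), pderiv_wave_one α j (hF n),
          pderiv_wave_two α j (hF n)]
        have hk : ∀ k, ‖p.snd x k‖ ≤ ‖p.snd x‖ := fun k => PiLp.norm_apply_le _ _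
        refine (norm_add_le _ _).trans (add_le_add ((norm_add_le _ _).trans
          (add_le_add ?_ ?_)) ?_)
        · rw [norm_mul, RCLike.norm_conj, norm_mul, norm_mul, Complex.norm_I, one_mul, norm_wave,
            Complex.norm_real, Real.norm_eq_abs]
          exact mul_le_mul (mul_le_mul_of_nonneg_left hb1 (abs_nonneg _)) (hk 0) (norm_nonneg _)
            (by positivity)
        · rw [norm_mul, RCLike.norm_conj, norm_mul, norm_mul, Complex.norm_I, one_mul, norm_wave,
            Complex.norm_real, Real.norm_eq_abs]
          exact mul_le_mul (mul_le_mul_of_nonneg_left hb1 (abs_nonneg _)) (hk 1) (norm_nonneg _)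
            (by positivity)
        · rw [norm_mul, RCLike.norm_conj, norm_wave]
          exact mul_le_mul hb2 (hk 2) (norm_nonneg _) hC0
    · filter_upwards [ae_restrict_mem (measurableSet_cell R)] with x hx
      refine tendsto_nhds_of_eventually_eq ?_
      filter_upwards [hlim (x 2) hx.2.2] with n hn
      simp only [inner_grad, pderiv_wave_zero α j (hF n), pderiv_wave_one α j (hF n),
        pderiv_wave_two α j (hF n), pderiv_wave_zero α j hf, pderiv_wave_one α j hf,
        pderiv_wave_two α j hf, wave, hn.1, hn.2]
  rw [hsum hf]
  simp only [← hsum (hF _), hzero] at htend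
  exact tendsto_nhds_unique htend tendsto_const_nhds |>.symm ▸ rfl

theorem pderiv_const_mul {f : (Fin 3 → ℝ) → ℂ} (hf : ContDiff ℝ ∞ f) (c : ℂ) (i : Fin 3)
    (x : Fin 3 → ℝ) : pderiv i (fun y => c * f y) x = c * pderiv i f x := by
  unfold pderiv
  rw [fderiv_const_mul (hf.differentiable (by simp)).differentiableAt]
  rfl

/-- On waves the Laplacian becomes an ordinary differential operator on the profile. -/
theorem div_grad_wave (α : Fin 2 → ℝ) (j : Fin 2 → ℤ) {f : ℝ → ℂ} (hf : ContDiff ℝ ∞ f)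
    (x : Fin 3 → ℝ) : div (grad (wave α j f)) x = wave α j (fun t => deriv (deriv f) t -
      (((j 0 - α 0) ^ 2 + (j 1 - α 1) ^ 2 : ℝ) : ℂ) * f t) x := by
  have hf' : ContDiff ℝ ∞ (deriv f) := (contDiff_infty_iff_deriv.1 hf).2
  have hw := (isSmoothQP_wave α j hf).smooth
  have e0 : (fun y => grad (wave α j f) y 0) =
      fun y => Complex.I * ((j 0 - α 0 : ℝ) : ℂ) * wave α j f y :=
    funext fun y => pderiv_wave_zero α j hf y
  have e1 : (fun y => grad (wave α j f) y 1) =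
      fun y => Complex.I * ((j 1 - α 1 : ℝ) : ℂ) * wave α j f y :=
    funext fun y => pderiv_wave_one α j hf y
  have e2 : (fun y => grad (wave α j f) y 2) = wave α j (deriv f) :=
    funext fun y => pderiv_wave_two α j hf y
  rw [div, e0, e1, e2, pderiv_const_mul hw, pderiv_const_mul hw, pderiv_wave_zero α j hf,
    pderiv_wave_one α j hf, pderiv_wave_two α j hf']
  simp only [wave]
  push_cast
  linear_combination ((((j 0 : ℂ) - α 0) ^ 2 + ((j 1 : ℂ) - α 1) ^ 2) * (Complex.exp (Complex.I *
    (((j 0 : ℂ) - α 0) * x 0 + ((j 1 : ℂ) - α 1) * x 1)) * f (x 2))) * Complex.I_sq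

/-- Density in `W₀` of the smooth quasi-periodic functions that vanish near the faces: only zero is
orthogonal to all of them. -/
theorem W₀.eq_zero_of_inner_smoothPair {α : Fin 2 → ℝ} {R : ℝ} (hR : 0 < R)
    {p : WithLp 2 (L2Scalar R × L2Field R)} (hpW : p ∈ W₀ α R)
    (hp : ∀ (φ : (Fin 3 → ℝ) → ℂ) (hφ : IsSmoothQP α φ), VanishesNearFaces R φ →
      inner ℂ (smoothPair R hφ) p = 0) : p = 0 := by
  have hmode : ∀ n, ∫ x in cell R, conj (mode α R n x) * p.fst x = 0 := by
    intro n
    set κ : ℝ := 2 * Real.pi * n 2 / R with hκ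
    set l : ℝ := (n 0 - α 0) ^ 2 + (n 1 - α 1) ^ 2 with hl
    have hl0 : 0 ≤ l := by positivity
    set μ : ℝ := Real.sqrt (1 + l) with hμ
    have hμ2 : (μ : ℂ) ^ 2 = 1 + l := by
      rw [← Complex.ofReal_pow, hμ, Real.sq_sqrt (by positivity)]
      simp
    set e : ℂ := Complex.exp (μ * R) with he
    have hene : 1 + e ≠ 0 := by
      have h : 1 + e = ((1 + Real.exp (μ * R) : ℝ) : ℂ) := by simp [he]
      rw [h]
      exact_mod_cast (by positivity : (1 + Real.exp (μ * R)) ≠ 0)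
    let E : ℂ → ℝ → ℂ := fun c t => Complex.exp (c * t)
    have hE : ∀ c, ContDiff ℝ ∞ (E c) := contDiff_cexp_mul
    have hEd : ∀ c t, HasDerivAt (E c) (c * E c t) t := fun c t => by
      have := ((hE c).differentiable (by simp)).differentiableAt.hasDerivAt (x := t)
      rwa [show deriv (E c) = _ from deriv_cexp_mul c] at this
    -- The subtracted profile equals `1` at `0` and at `R`, as does the exponential, so `f` vanishes
    -- at both ends. Since `μ ^ 2 = 1 + l`, its wave is annihilated by `1 - Δ`; hence `1 - Δ` sends
    -- the wave of `f` to `(1 + l + κ ^ 2)` times the mode.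
    let f : ℝ → ℂ := fun t => E (Complex.I * κ) t - (1 + e)⁻¹ * (E μ t + e * E (-μ) t)
    have hf : ContDiff ℝ ∞ f :=
      (hE _).sub (contDiff_const.mul ((hE _).add (contDiff_const.mul (hE _))))
    have hd1 : deriv f = fun t => Complex.I * κ * E (Complex.I * κ) t -
        (1 + e)⁻¹ * (μ * E μ t + e * (-μ * E (-μ) t)) := funext fun t =>
      ((hEd _ t).sub (((hEd _ t).add ((hEd _ t).const_mul e)).const_mul _)).deriv
    have hd2 : deriv (deriv f) = fun t => Complex.I * κ * (Complex.I * κ * E (Complex.I * κ) t) -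
        (1 + e)⁻¹ * (μ * (μ * E μ t) + e * (-μ * (-μ * E (-μ) t))) := by
      rw [hd1]
      exact funext fun t => (((hEd _ t).const_mul _).sub ((((hEd _ t).const_mul _).add
        (((hEd _ t).const_mul _).const_mul e)).const_mul _)).deriv
    have hf0 : f 0 = 0 := by
      simp [f, E, hene]
    have hfR : f R = 0 := by
      have h1 : E (Complex.I * κ) R = 1 := by
        have hRc : (R : ℂ) ≠ 0 := by exact_mod_cast hR.ne'
        refine Complex.exp_eq_one_iff.2 ⟨n 2, ?_⟩
        rw [hκ]
        push_cast
        field_simp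
      have h2 : e * E (-μ) R = 1 := by
        simp only [E, he]
        rw [← Complex.exp_add]
        simp
      have h3 : E μ R = e := rfl
      simp only [f]
      rw [h1, h2, h3, add_comm e 1, inv_mul_cancel₀ hene, sub_self]
    have hz := inner_wave_eq_zero hR hp ![n 0, n 1] hf hf0 hfR
    rw [inner_smoothPair] at hz
    -- Testing with the gradient of the wave moves the derivative off `p`. The difference of `hz`
    -- and `hw` pairs `p.fst` with `(1 - Δ)` of the wave, that is, with a nonzero multiple of the
    -- mode.
    have hw := hpW _ (isSmoothQP_wave α ![n 0, n 1] hf).grad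
    simp only [Pi.zero_apply, mul_zero, integral_zero, sub_zero, div_grad_wave α _ hf] at hw
    have hdd : ContDiff ℝ ∞ fun t => deriv (deriv f) t - (((![n 0, n 1] 0 - α 0 : ℝ) ^ 2 +
        (![n 0, n 1] 1 - α 1 : ℝ) ^ 2 : ℝ) : ℂ) * f t :=
      ((contDiff_infty_iff_deriv.1 (contDiff_infty_iff_deriv.1 hf).2).2).sub
        (contDiff_const.mul hf)
    have hint : ∀ {g : ℝ → ℂ} (_ : ContDiff ℝ ∞ g), Integrable
        (fun x => conj (wave α ![n 0, n 1] g x) * p.fst x) (volume.restrict (cell R)) := by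
      intro g hg
      refine (integrable_pair (memLp_cell (isSmoothQP_wave α ![n 0, n 1] hg).smooth.continuous
        R) p.fst).congr (.of_forall fun x => ?_)
      simp [mul_comm]
    have hsub := integral_sub (hint hf) (hint hdd)
    have hpt : ∀ x, conj (wave α ![n 0, n 1] f x) * p.fst x -
        conj (wave α ![n 0, n 1] (fun t => deriv (deriv f) t - (((![n 0, n 1] 0 - α 0 : ℝ) ^ 2 +
        (![n 0, n 1] 1 - α 1 : ℝ) ^ 2 : ℝ) : ℂ) * f t) x) * p.fst x =
        ((1 + l + κ ^ 2 : ℝ) : ℂ) * (conj (mode α R n x) * p.fst x) := by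
      intro x
      rw [← sub_mul, ← mul_assoc, ← map_sub, ← Complex.conj_ofReal (1 + l + κ ^ 2), ← map_mul]
      congr 2
      rw [mode_eq_wave]
      simp only [wave, hd2, f, ← hκ]
      simp only [Matrix.cons_val_zero, Matrix.cons_val_one, ← hl, E]
      push_cast
      linear_combination Complex.exp (Complex.I *
        (((n 0 : ℂ) - α 0) * x 0 + ((n 1 : ℂ) - α 1) * x 1)) *
        (-(κ : ℂ) ^ 2 * Complex.exp (Complex.I * κ * x 2) * Complex.I_sq +
        (1 + e)⁻¹ * (Complex.exp (μ * x 2) + e * Complex.exp (-μ * x 2)) * hμ2)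
    simp only [hpt] at hsub
    rw [integral_const_mul] at hsub
    have hne : ((1 + l + κ ^ 2 : ℝ) : ℂ) ≠ 0 := by
      have : 0 < 1 + l + κ ^ 2 := by positivity
      exact_mod_cast this.ne'
    refine (mul_eq_zero.1 (hsub.trans ?_)).resolve_left hne
    linear_combination hz - hw
  have hfst : p.fst = 0 := by
    refine Lp.ext ?_
    filter_upwards [ae_eq_zero_of_mode hR (Lp.memLp p.fst) hmode,
      Lp.coeFn_zero ℂ 2 (volume.restrict (cell R))] with x h1 h2
    rw [h1, h2]
  have hsnd : p.snd = 0 := by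
    refine field_eq_zero_of_mode (α := α) hR fun n k => ?_
    rw [W₀.integral_pderiv hpW (isSmoothQP_mode α R n) k, hfst]
    simpa using spair_smul (pderiv k (mode α R n)) 0 (0 : L2Scalar R)
  exact (WithLp.equiv 2 _).injective (Prod.ext hfst hsnd)

/-! ### The gradient and the weighted divergence as operators. -/

/-- The gradient as a bounded operator on `W₀`. -/
def gradW₀ (α : Fin 2 → ℝ) (R : ℝ) : W₀ α R →L[ℂ] L2Field R :=
  (WithLp.sndL 2 ℂ (L2Scalar R) (L2Field R)).comp (W₀ α R).subtypeL

@[simp]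
theorem gradW₀_apply {α : Fin 2 → ℝ} {R : ℝ} (w : W₀ α R) : gradW₀ α R w = w.1.snd := rfl

theorem norm_le_gradW₀ {α : Fin 2 → ℝ} {R : ℝ} (hR : 0 < R) (w : W₀ α R) :
    ‖w‖ ^ 2 ≤ (2 * R ^ 2 + 1) * ‖gradW₀ α R w‖ ^ 2 := by
  have h := W₀.poincare hR w.2
  have hw : ‖w‖ = ‖w.1‖ := rfl
  rw [hw, WithLp.prod_norm_sq_eq_of_L2, gradW₀_apply]
  linarith

theorem isClosed_range_gradW₀ (α : Fin 2 → ℝ) {R : ℝ} (hR : 0 < R) :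
    IsClosed (range (gradW₀ α R)) := by
  have hanti : AntilipschitzWith (Real.sqrt (2 * R ^ 2 + 1)).toNNReal (gradW₀ α R) := by
    refine (gradW₀ α R).antilipschitz_of_bound fun w => ?_
    rw [Real.coe_toNNReal _ (Real.sqrt_nonneg _)]
    refine abs_le_of_sq_le_sq' ?_ (by positivity) |>.2
    rw [mul_pow, Real.sq_sqrt (by positivity)]
    exact norm_le_gradW₀ hR w
  exact hanti.isClosed_range (gradW₀ α R).uniformContinuous

section Coefficient

variable {R : ℝ} {ε : (Fin 3 → ℝ) → ℂ} (hε : MemLp ε ⊤ (volume.restrict (cell R)))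

/-- The weak divergence `u ↦ -div (ε u)`, as an operator into `W₀`. -/
def weightedDiv (α : Fin 2 → ℝ) : L2Field R →L[ℂ] W₀ α R :=
  (ContinuousLinearMap.adjoint (gradW₀ α R)).comp (mulCoeff hε)

theorem integral_inner_coeff (v u : L2Field R) :
    ∫ x in cell R, inner ℂ (v x) (ε x • u x) = inner ℂ v (mulCoeff hε u) := by
  rw [L2.inner_def]
  refine integral_congr_ae ?_
  filter_upwards [coeFn_mulCoeff hε u] with x hx
  rw [hx]

theorem inner_weightedDiv {α : Fin 2 → ℝ} (v : W₀ α R) (u : L2Field R) :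
    inner ℂ v (weightedDiv hε α u) = ∫ x in cell R, inner ℂ (v.1.snd x) (ε x • u x) := by
  rw [integral_inner_coeff hε, weightedDiv, ContinuousLinearMap.comp_apply,
    ContinuousLinearMap.adjoint_inner_right, gradW₀_apply]

/-- The quadratic form is `∫ ε |∇v|²`, with real part at least `ε₀ ‖∇v‖²`; the factor `2 * R ^ 2 +
1` passes from `‖∇v‖²` to the full norm of `W₀`. -/
theorem bijective_weightedDiv_grad (α : Fin 2 → ℝ) (hR : 0 < R) {ε₀ : ℝ} (hε₀ : 0 < ε₀)
    (hre : ∀ᵐ x ∂(volume.restrict (cell R)), ε₀ ≤ (ε x).re) :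
    Function.Bijective ((weightedDiv hε α).comp (gradW₀ α R)) := by
  refine bijective_of_coercive _ (c := ε₀ / (2 * R ^ 2 + 1)) (by positivity) fun v => ?_
  have h1 := re_inner_mulCoeff hε hre (gradW₀ α R v)
  rw [ContinuousLinearMap.comp_apply, inner_weightedDiv, integral_inner_coeff hε]
  refine le_trans ?_ h1
  rw [div_mul_eq_mul_div, div_le_iff₀ (by positivity), mul_assoc]
  refine mul_le_mul_of_nonneg_left ?_ hε₀.le
  rw [mul_comm]
  exact norm_le_gradW₀ hR v

/-- The distributional equation `div (ε u) = 0` is the equation against all of `W₀`. -/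
theorem divZero_iff (α : Fin 2 → ℝ) (hR : 0 < R) (u : L2Field R) :
    DivZero α R ε u ↔ weightedDiv hε α u = 0 := by
  have key : ∀ (φ : (Fin 3 → ℝ) → ℂ) (hφ : IsSmoothQP α φ) (hs : VanishesNearFaces R φ),
      inner ℂ (⟨smoothPair R hφ, smoothPair_mem hR hφ hs⟩ : W₀ α R) (weightedDiv hε α u) =
        ∫ x in cell R, inner ℂ (grad φ x) (ε x • u x) := by
    intro φ hφ hs
    rw [inner_weightedDiv]
    refine integral_congr_ae ?_
    filter_upwards [(memLp_cell (continuous_grad hφ.smooth) R).coeFn_toLp] with x hx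
    rw [← hx]
    rfl
  constructor
  · intro h
    -- The distributional equation says that the element `weightedDiv hε α u` of `W₀` is orthogonal
    -- to a dense subspace.
    refine Subtype.ext (W₀.eq_zero_of_inner_smoothPair hR (weightedDiv hε α u).2
      fun φ hφ hs => ?_)
    exact (key φ hφ hs).trans (h φ hφ hs)
  · intro h φ hφ hs
    rw [← key φ hφ hs, h, inner_zero_right]

theorem solvesWeighted_iff {α : Fin 2 → ℝ} (E : L2Field R) (w : W₀ α R) :
    SolvesWeighted α R ε E w ↔
      weightedDiv hε α (gradW₀ α R w) = weightedDiv hε α E := by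
  constructor
  · intro h
    refine ext_inner_left ℂ fun v => ?_
    rw [inner_weightedDiv, inner_weightedDiv]
    exact h v
  · intro h v
    rw [← inner_weightedDiv hε v E, ← h, inner_weightedDiv]
    rfl

end Coefficient

end QPMaxwell

end

/-! ### The decomposition. -/

theorem mainTheorem10 (α : Fin 2 → ℝ) (R : ℝ) (hR : 0 < R)
    (ε : (Fin 3 → ℝ) → ℂ)
    (hε : MemLp ε ∞ (volume.restrict QPMaxwell.halfSpace))
    (hper : ∀ j : Fin 2 → ℤ, ∀ᵐ x ∂(volume.restrict QPMaxwell.halfSpace),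
      ε (x + QPMaxwell.period j) = ε x)
    (ε₀ : ℝ) (hε₀ : 0 < ε₀)
    (hre : ∀ᵐ x ∂(volume.restrict QPMaxwell.halfSpace), ε₀ ≤ (ε x).re) :
    IsClosed (QPMaxwell.Y α R ε hε : Set (QPMaxwell.X α R)) ∧
    IsClosed (QPMaxwell.Yperp α R : Set (QPMaxwell.X α R)) ∧
    IsCompl (QPMaxwell.Y α R ε hε) (QPMaxwell.Yperp α R) ∧
    ∀ E : QPMaxwell.X α R, ∃ w : QPMaxwell.W₀ α R,
      (∀ w' : QPMaxwell.W₀ α R, QPMaxwell.SolvesWeighted α R ε E.1.fst w' ↔ w' = w) ∧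
      ∃ y ∈ QPMaxwell.Y α R ε hε, ∃ z ∈ QPMaxwell.Yperp α R,
        E = y + z ∧ z.1.fst = w.1.snd := by
  have hεc := hε.mono_measure
    (Measure.restrict_mono (QPMaxwell.cell_subset_halfSpace R) le_rfl)
  have hrec := ae_restrict_of_ae_restrict_of_subset (QPMaxwell.cell_subset_halfSpace R) hre
  have hbij := QPMaxwell.bijective_weightedDiv_grad hεc α hR hε₀ hrec
  have hcont : Continuous fun p : QPMaxwell.X α R => p.1.fst :=
    (WithLp.fstL 2 ℂ (QPMaxwell.L2Field R) _).continuous.comp continuous_subtype_val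
  have hY : ∀ p : QPMaxwell.X α R, p ∈ QPMaxwell.Y α R ε hε ↔
      QPMaxwell.weightedDiv hεc α p.1.fst = 0 := fun p => QPMaxwell.divZero_iff hεc α hR p.1.fst
  have hYp : ∀ p : QPMaxwell.X α R, p ∈ QPMaxwell.Yperp α R ↔
      p.1.fst ∈ range (QPMaxwell.gradW₀ α R) := by
    intro p
    constructor
    · rintro ⟨w, hw, h⟩
      exact ⟨⟨w, hw⟩, h.symm⟩
    · rintro ⟨w, h⟩
      exact ⟨w.1, w.2, h.symm⟩
  have hsol : ∀ E : QPMaxwell.X α R, ∃ w : QPMaxwell.W₀ α R,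
      (∀ w' : QPMaxwell.W₀ α R, QPMaxwell.SolvesWeighted α R ε E.1.fst w' ↔ w' = w) ∧
      ∃ y ∈ QPMaxwell.Y α R ε hε, ∃ z ∈ QPMaxwell.Yperp α R,
        E = y + z ∧ z.1.fst = w.1.snd := by
    intro E
    obtain ⟨w, hw⟩ := hbij.2 (QPMaxwell.weightedDiv hεc α E.1.fst)
    rw [ContinuousLinearMap.comp_apply] at hw
    -- The gradient is lifted to `X` with zero curl and zero trace coefficients.
    let z : QPMaxwell.X α R := ⟨_, QPMaxwell.W₀.gradient_mem_X w.2⟩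
    have hz : z.1.fst = QPMaxwell.gradW₀ α R w := rfl
    refine ⟨w, fun w' => ?_, E - z, ?_, z, (hYp z).2 ⟨w, rfl⟩, (sub_add_cancel E z).symm, rfl⟩
    · rw [QPMaxwell.solvesWeighted_iff hεc, ← hw]
      exact hbij.1.eq_iff
    · rw [hY, Submodule.coe_sub, WithLp.sub_fst, map_sub, hz, hw, sub_self]
  refine ⟨?_, ?_, ⟨?_, ?_⟩, hsol⟩
  · have h : (QPMaxwell.Y α R ε hε : Set (QPMaxwell.X α R)) =
        {p | QPMaxwell.weightedDiv hεc α p.1.fst = 0} := Set.ext hY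
    rw [h]
    exact isClosed_eq ((QPMaxwell.weightedDiv hεc α).continuous.comp hcont) continuous_const
  · have h : (QPMaxwell.Yperp α R : Set (QPMaxwell.X α R)) =
        (fun p : QPMaxwell.X α R => p.1.fst) ⁻¹' range (QPMaxwell.gradW₀ α R) := Set.ext hYp
    rw [h]
    exact (QPMaxwell.isClosed_range_gradW₀ α hR).preimage hcont
  · rw [Submodule.disjoint_def]
    intro p hp hp'
    obtain ⟨w, hw⟩ := (hYp p).1 hp'
    rw [hY, ← hw] at hp
    have hw0 : w = 0 := hbij.1 (hp.trans (map_zero _).symm)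
    rw [hw0, map_zero] at hw
    -- Only the field is known to vanish so far; the curl and the trace coefficients must follow it.
    exact Subtype.ext (QPMaxwell.X.eq_zero_of_fst hR p.2 hw.symm)
  · rw [codisjoint_iff, Submodule.eq_top_iff']
    intro E
    obtain ⟨w, -, y, hy, z, hz, h, -⟩ := hsol E
    rw [h]
    exact Submodule.add_mem_sup hy hz
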